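/- Let $\Gamma$ be a countably infinite amenable discrete group acting by homeomorphisms on the Cantor set $X$, and suppose the action is topologically free, i.e. the set of points of $X$ with trivial stabilizer is dense. (Amenability: for all finite $T\subseteq\Gamma$ and $\delta>0$ there is a nonempty finite $F\subseteq\Gamma$ with $|F\cap\bigcap_{s\in T}s^{-1}F|\ge(1-\delta)|F|$.) Let $[[\Gamma\curvearrowright X]]$ be the topological full group: the group of all homeomorphisms $T:X\to X$ for which there are a partition of $X$ into finitely many clopen sets $A_1,\dots,A_n$ and elements $s_1,\dots,s_n\in\Gamma$ with $Tx=s_ix$ for all $i$ and all $x\in A_i$. Let $\mathfrak A(\Gamma,X)\le[[\Gamma\curvearrowright X]]$ be the subgroup generated by the images $\varphi(\mathfrak A_3)$ of the alternating group $\mathfrak A_3\subseteq\mathfrak S_3$ under all homomorphisms $\varphi:\mathfrak S_3\to[[\Gamma\curvearrowright X]]$ for which there exist pairwise disjoint clopen sets $A_1,A_2,A_3\subseteq X$ such that, for every $\sigma\in\mathfrak S_3$, $\varphi(\sigma)$ is the identity off $A_1\sqcup A_2\sqcup A_3$ and $\varphi(\sigma)A_i=A_{\sigma(i)}$ for $i=1,2,3$.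 Then every subgroup $G$ of $[[\Gamma\curvearrowright X]]$ containing $\mathfrak A(\Gamma,X)$ has property Gamma. That is: $G$ is ICC (the conjugacy class of every $g\in G\setminus\{1\}$ is infinite); the group von Neumann algebra $\mathscr L G=\lambda(G)''\subseteq B(\ell^2(G))$ generated by the left regular representation $\lambda$, with its canonical trace $\tau(a)=\langle a\delta_1,\delta_1\rangle$, is a II$_1$ factor (an infinite-dimensional factor on which $\tau$ is a faithful normal tracial state); and for every $\varepsilon>0$ and every finite set $\Omega\subseteq\mathscr L G$ there is a unitary $u\in\mathscr L G$ with $\tau(u)=0$ and $\|au-ua\|_2<\varepsilon$ for all $a\in\Omega$, where $\|x\|_2=\tau(x^*x)^{1/2}$. -/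

import Mathlib

/-! ### Amenability and topological freeness -/

/-- A finite set `F` in a group is `(T, δ)`-invariant if
`|F ∩ ⋂ s ∈ T, s⁻¹ F| ≥ (1 - δ) |F|`. -/
def IsInvariantUpTo {Γ : Type*} [Group Γ] (T : Finset Γ) (δ : ℝ) (F : Finset Γ) : Prop :=
  (1 - δ) * (F.card : ℝ) ≤ (Set.ncard {t : Γ | t ∈ F ∧ ∀ s ∈ T, s * t ∈ F} : ℝ)

/-- Amenability of a discrete group (Følner's condition): for every finite `T` and `δ > 0` there
is a nonempty finite `(T, δ)`-invariant set. -/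
def IsAmenableGroup (Γ : Type*) [Group Γ] : Prop :=
  ∀ (T : Finset Γ) (δ : ℝ), 0 < δ → ∃ F : Finset Γ, F.Nonempty ∧ IsInvariantUpTo T δ F

/-- An action is topologically free if the points with trivial stabilizer are dense. -/
def IsTopologicallyFree (Γ X : Type*) [Group Γ] [TopologicalSpace X] [MulAction Γ X] : Prop :=
  Dense {x : X | MulAction.stabilizer Γ x = ⊥}

/-! ### The topological full group and the alternating group -/

section FullGroup

variable (Γ : Type*) {X : Type*} [Group Γ] [TopologicalSpace X] [MulAction Γ X]

/-- `T` is piecewise given by group elements: there are a partition of `X` into finitely many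
clopen sets `A i` and elements `s i` with `T x = s i • x` for `x ∈ A i`. -/
def IsPiecewiseAction (T : X ≃ₜ X) : Prop :=
  ∃ (n : ℕ) (A : Fin n → Set X) (s : Fin n → Γ),
    (∀ i, IsClopen (A i)) ∧ Pairwise (Function.onFun Disjoint A) ∧ (⋃ i, A i) = Set.univ ∧
      ∀ i, ∀ x ∈ A i, T x = s i • x

variable {Γ}

theorem IsPiecewiseAction.of_finite {T : X ≃ₜ X} {ι : Type*} [Finite ι] (A : ι → Set X)
    (s : ι → Γ) (h1 : ∀ i, IsClopen (A i)) (h2 : Pairwise (Function.onFun Disjoint A))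
    (h3 : (⋃ i, A i) = Set.univ) (h4 : ∀ i, ∀ x ∈ A i, T x = s i • x) :
    IsPiecewiseAction Γ T := by
  obtain ⟨n, ⟨e⟩⟩ := Finite.exists_equiv_fin ι
  refine ⟨n, A ∘ e.symm, s ∘ e.symm, fun i => h1 _, ?_, ?_, fun i => h4 _⟩
  · intro i j hij
    exact h2 (fun h => hij (e.symm.injective h))
  · rw [← h3]
    exact e.symm.surjective.iUnion_comp A

variable (Γ X)

/-- The topological full group of the action of `Γ` on `X`. -/
def topologicalFullGroup : Subgroup (X ≃ₜ X) where
  carrier := {T | IsPiecewiseAction Γ T}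
  one_mem' := by
    refine IsPiecewiseAction.of_finite (ι := Unit) (fun _ => Set.univ) (fun _ => 1)
      (fun _ => isClopen_univ) (fun i j h => (h rfl).elim) (Set.iUnion_const _) ?_
    intro i x _
    exact (one_smul Γ x).symm
  mul_mem' := by
    rintro S T ⟨n, A, s, hA1, hA2, hA3, hA4⟩ ⟨m, B, t, hB1, hB2, hB3, hB4⟩
    refine IsPiecewiseAction.of_finite (ι := Fin n × Fin m)
      (fun p => T ⁻¹' A p.1 ∩ B p.2) (fun p => s p.1 * t p.2) ?_ ?_ ?_ ?_
    · exact fun p => ((hA1 p.1).preimage T.continuous).inter (hB1 p.2)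
    · rintro ⟨i, j⟩ ⟨i', j'⟩ hne
      refine Set.disjoint_left.2 ?_
      rintro x ⟨hx1, hx2⟩ ⟨hx3, hx4⟩
      have hi : i = i' := by
        by_contra h
        exact Set.disjoint_left.1 (hA2 h) hx1 hx3
      have hj : j = j' := by
        by_contra h
        exact Set.disjoint_left.1 (hB2 h) hx2 hx4
      exact hne (by rw [hi, hj])
    · refine Set.eq_univ_of_forall fun x => ?_
      have h1 : T x ∈ ⋃ i, A i := hA3 ▸ Set.mem_univ _
      have h2 : x ∈ ⋃ i, B i := hB3 ▸ Set.mem_univ _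
      obtain ⟨i, hi⟩ := Set.mem_iUnion.1 h1
      obtain ⟨j, hj⟩ := Set.mem_iUnion.1 h2
      exact Set.mem_iUnion.2 ⟨(i, j), hi, hj⟩
    · rintro ⟨i, j⟩ x ⟨hx1, hx2⟩
      rw [Homeomorph.mul_apply, hA4 i _ hx1, hB4 j _ hx2, mul_smul]
  inv_mem' := by
    rintro T ⟨n, A, s, hA1, hA2, hA3, hA4⟩
    refine IsPiecewiseAction.of_finite (ι := Fin n) (fun i => T.symm ⁻¹' A i)
      (fun i => (s i)⁻¹) ?_ ?_ ?_ ?_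
    · exact fun i => (hA1 i).preimage T.symm.continuous
    · exact fun i j h => (hA2 h).preimage _
    · rw [← Set.preimage_iUnion, hA3, Set.preimage_univ]
    · intro i x hx
      have h := hA4 i _ hx
      rw [Homeomorph.apply_symm_apply] at h
      change T.symm x = _
      rw [eq_inv_smul_iff]
      exact h.symm

/-- The homomorphisms `φ` from the symmetric group on `d` letters to the topological full group for
which there are pairwise disjoint clopen sets `A i` such that each `φ σ` is the identity off their
union and maps `A i` onto `A (σ i)`. -/
def IsSymmetricEmbedding {d : ℕ} (φ : Equiv.Perm (Fin d) →* topologicalFullGroup Γ X) : Prop :=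
  ∃ A : Fin d → Set X,
    (∀ i, IsClopen (A i)) ∧ Pairwise (Function.onFun Disjoint A) ∧
      ∀ σ : Equiv.Perm (Fin d),
        (∀ x, x ∉ ⋃ i, A i → (φ σ : X ≃ₜ X) x = x) ∧
          ∀ i, (φ σ : X ≃ₜ X) '' A i = A (σ i)

/-- The subgroup of the topological full group generated by the images of the alternating group on
`d` letters under the above homomorphisms. -/
def dynamicalAlternatingGroupOfDegree (d : ℕ) : Subgroup (topologicalFullGroup Γ X) :=
  Subgroup.closure {g | ∃ φ : Equiv.Perm (Fin d) →* topologicalFullGroup Γ X,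
    IsSymmetricEmbedding Γ X φ ∧ ∃ σ ∈ alternatingGroup (Fin d), φ σ = g}

/-- The alternating group `𝔄(Γ, X)` of the action. -/
def dynamicalAlternatingGroup : Subgroup (topologicalFullGroup Γ X) :=
  dynamicalAlternatingGroupOfDegree Γ X 3

end FullGroup

/-! ### II₁ factors and property Gamma -/

section VonNeumann

variable {H : Type*} [NormedAddCommGroup H] [InnerProductSpace ℂ H] [CompleteSpace H]

/-- A von Neumann algebra is a factor if its center consists of the scalars. -/
def IsFactor (M : VonNeumannAlgebra H) : Prop :=
  ∀ z ∈ M, z ∈ M.commutant → ∃ c : ℂ, z = c • (1 : H →L[ℂ] H)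

/-- `τ` is a faithful normal tracial state on `M`. Normality is expressed as ultraweak continuity:
`τ` is of the form `a ↦ ∑ n, ⟪ξ n, a (η n)⟫` with `ξ, η` square-summable. -/
structure IsFaithfulNormalTracialState (M : VonNeumannAlgebra H)
    (τ : M.toStarSubalgebra →ₗ[ℂ] ℂ) : Prop where
  map_one : τ 1 = 1
  nonneg : ∀ a, 0 ≤ (τ (star a * a)).re ∧ (τ (star a * a)).im = 0
  faithful : ∀ a, τ (star a * a) = 0 → a = 0
  tracial : ∀ a b, τ (a * b) = τ (b * a)
  normal : ∃ ξ η : ℕ → H, Summable (fun n => ‖ξ n‖ ^ 2) ∧ Summable (fun n => ‖η n‖ ^ 2) ∧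
    ∀ a : M.toStarSubalgebra, HasSum (fun n => inner ℂ (ξ n) ((a : H →L[ℂ] H) (η n))) (τ a)

/-- `M` is a II₁ factor with trace `τ`. -/
structure IsIIOneFactor (M : VonNeumannAlgebra H) (τ : M.toStarSubalgebra →ₗ[ℂ] ℂ) : Prop where
  factor : IsFactor M
  infinite_dimensional : ¬ FiniteDimensional ℂ M.toStarSubalgebra
  trace : IsFaithfulNormalTracialState M τ

/-- The norm `‖a‖₂ = τ(a* a)^{1/2}`. -/
noncomputable def traceNorm (M : VonNeumannAlgebra H) (τ : M.toStarSubalgebra →ₗ[ℂ] ℂ)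
    (a : M.toStarSubalgebra) : ℝ :=
  Real.sqrt (τ (star a * a)).re

/-- `M` is a II₁ factor with trace `τ` and has property Gamma. -/
structure IsIIOneFactorWithGamma (M : VonNeumannAlgebra H)
    (τ : M.toStarSubalgebra →ₗ[ℂ] ℂ) : Prop where
  isIIOneFactor : IsIIOneFactor M τ
  gamma : ∀ ε : ℝ, 0 < ε → ∀ Ω : Finset M.toStarSubalgebra,
    ∃ u ∈ unitary M.toStarSubalgebra, τ u = 0 ∧
      ∀ a ∈ Ω, traceNorm M τ (a * u - u * a) < ε

/-- The von Neumann algebra generated by a set `S` of operators, i.e. the double commutant of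
`S ∪ S*`. -/
noncomputable def vonNeumannGenerated (S : Set (H →L[ℂ] H)) : VonNeumannAlgebra H where
  toStarSubalgebra :=
    StarSubalgebra.centralizer ℂ (StarSubalgebra.centralizer ℂ S : Set (H →L[ℂ] H))
  centralizer_centralizer' := by
    have h := StarSubalgebra.coe_centralizer_centralizer (R := ℂ) S
    change Set.centralizer (Set.centralizer
      (StarSubalgebra.centralizer ℂ (StarSubalgebra.centralizer ℂ S : Set (H →L[ℂ] H)) :
        Set (H →L[ℂ] H))) =
      (StarSubalgebra.centralizer ℂ (StarSubalgebra.centralizer ℂ S : Set (H →L[ℂ] H)) :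
        Set (H →L[ℂ] H))
    rw [h, Set.centralizer_centralizer_centralizer]

end VonNeumann

/-! ### Group von Neumann algebras -/

section GroupVN

variable {G : Type*} [Group G]

/-- The left regular representation on `ℓ²(G)`: `(λ_g f)(h) = f(g⁻¹ h)`. -/
noncomputable def leftRegular (g : G) : lp (fun _ : G => ℂ) 2 →ₗᵢ[ℂ] lp (fun _ : G => ℂ) 2 where
  toFun f := ⟨fun h => f (g⁻¹ * h), memℓp_gen
    ((Equiv.mulLeft g⁻¹).summable_iff.2 ((lp.memℓp f).summable (by norm_num)))⟩
  map_add' _ _ := rfl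
  map_smul' _ _ := rfl
  norm_map' f := by
    rw [lp.norm_eq_tsum_rpow (by norm_num), lp.norm_eq_tsum_rpow (by norm_num)]
    exact congrArg (· ^ _) ((Equiv.mulLeft g⁻¹).tsum_eq
      (fun h => ‖f h‖ ^ (2 : ENNReal).toReal))

variable (G)

/-- The group von Neumann algebra, generated by the left regular representation. -/
noncomputable def groupVonNeumannAlgebra : VonNeumannAlgebra (lp (fun _ : G => ℂ) 2) :=
  vonNeumannGenerated (Set.range fun g : G => (leftRegular g).toContinuousLinearMap)

open Classical in
/-- The canonical trace `τ(a) = ⟪δ_1, a δ_1⟫` on the group von Neumann algebra. -/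
noncomputable def groupTrace : (groupVonNeumannAlgebra G).toStarSubalgebra →ₗ[ℂ] ℂ where
  toFun a := inner ℂ (lp.single 2 (1 : G) (1 : ℂ) : lp (fun _ : G => ℂ) 2)
    ((a : lp (fun _ : G => ℂ) 2 →L[ℂ] lp (fun _ : G => ℂ) 2) (lp.single 2 (1 : G) (1 : ℂ)))
  map_add' a b := by simp
  map_smul' c a := by simp

/-- All nontrivial conjugacy classes are infinite. -/
def IsICC : Prop :=
  ∀ g : G, g ≠ 1 → (conjugatesOf g).Infinite

/-- The group `G` is ICC and its group von Neumann algebra, with its canonical trace, is a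
II₁ factor with property Gamma. -/
def HasPropertyGamma : Prop :=
  IsICC G ∧ IsIIOneFactorWithGamma (groupVonNeumannAlgebra G) (groupTrace G)

end GroupVN

/-!
The unitary required by property Gamma is a function of commuting involutions of `G`. If an
embedding `h : (Fin n → ℤˣ) →* G` is approximately permuted under conjugation by finitely many
elements of `G`, then the sum of the `n` involutions it provides is almost invariant: conjugation
replaces a sum over most of the coordinates by another such sum. Under the trace the involutions
are independent fair signs, so a function `F` of their sum with Lipschitz constant `O(1 / √n)`
moves by little in `‖·‖₂` when few coordinates are dropped, and `F` of the sum asymptotically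
commutes with the given elements. The phases `F x = exp (i s sin (t x))` with `t = π / (2 √n)` give
unitaries; since the sum has standard deviation `√n`, their trace changes sign as `s` runs from `0`
to `π`, and so vanishes for some `s`.

The involutions come from towers over a small clopen neighborhood `A` of a point with trivial
stabilizer. Let `t₁, …, tₙ` enumerate a Følner set and choose `r₁, …, r₄` such that the translates
`tᵢ rⱼ A` are disjoint. The `i`-th involution is an even permutation of `tᵢ r₁ A, …, tᵢ r₄ A`, so it
lies in `𝔄(Γ, X)`. By the pigeonhole principle `r` can be chosen so that an element `g` of the full
group acts on these four levels by a single element `s` of a fixed finite subset of `Γ`. It then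
conjugates the `i`-th involution to the `k`-th whenever `s tᵢ = tₖ`, which happens for most `i`.
-/

open scoped BigOperators

/-! ### Random signs -/

section SignVectors

theorem expect_unitsHom {K F : Type*} [Group K] [Fintype K] [Field F] [CharZero F]
    {χ : K →* ℤˣ} (hχ : χ ≠ 1) : 𝔼 k, ((χ k : ℤ) : F) = 0 := by
  let χ' : K →* F := (Int.castRingHom F : ℤ →* F).comp ((Units.coeHom ℤ).comp χ)
  have hχ' : χ' ≠ 1 := by
    refine fun h => hχ (MonoidHom.ext fun k => Units.ext ?_)
    exact Int.cast_injective (α := F) ((DFunLike.congr_fun h k).trans Int.cast_one.symm)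
  have hsum : ∑ k, ((χ k : ℤ) : F) = 0 := sum_hom_units_eq_zero χ' hχ'
  rw [Fintype.expect_eq_sum_div_card, hsum, zero_div]

theorem expect_eq_zero_of_odd {K : Type*} [Fintype K] [InvolutiveNeg K] {F : K → ℝ}
    (hF : ∀ k, F (-k) = -F k) : 𝔼 k, F k = 0 := by
  have h := Fintype.expect_equiv (Equiv.neg K) F (fun k => F (-k)) fun k => by simp
  simp only [hF, Finset.expect_neg_distrib] at h
  linarith

variable {I : Type*}

/-- The sum `∑ i ∈ J, ε i` of the signs with index in `J`, as a real-valued random variable on the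
finite probability space `I → ℤˣ` of sign vectors. -/
def signSum (J : Finset I) (ε : I → ℤˣ) : ℝ := ∑ i ∈ J, ((ε i : ℤ) : ℝ)

theorem signSum_neg (J : Finset I) (ε : I → ℤˣ) : signSum J (-ε) = -signSum J ε := by
  simp only [signSum, Pi.neg_apply, Units.val_neg, Int.cast_neg, Finset.sum_neg_distrib]

variable [Fintype I] [DecidableEq I]

theorem signSum_univ_sub (J : Finset I) (ε : I → ℤˣ) :
    signSum Finset.univ ε - signSum J ε = signSum Jᶜ ε :=
  sub_eq_of_eq_add (Finset.sum_compl_add_sum J _).symm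

theorem expect_sign_mul_sign (i j : I) :
    𝔼 ε : I → ℤˣ, ((ε i : ℤ) : ℝ) * ((ε j : ℤ) : ℝ) = if i = j then 1 else 0 := by
  split_ifs with hij
  · subst hij
    have hone : ∀ ε : I → ℤˣ, ((ε i : ℤ) : ℝ) * ((ε i : ℤ) : ℝ) = 1 := fun ε => by
      rw [← Int.cast_mul, ← Units.val_mul, Int.units_mul_self, Units.val_one, Int.cast_one]
    simp only [hone, Fintype.expect_const]
  · let χ : (I → ℤˣ) →* ℤˣ := Pi.evalMonoidHom (fun _ => ℤˣ) i * Pi.evalMonoidHom (fun _ => ℤˣ) j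
    have hχ : χ ≠ 1 := fun h => by
      have hi : χ (Pi.mulSingle i (-1)) = -1 := by
        simp [χ, Pi.mulSingle_eq_of_ne (Ne.symm hij)]
      rw [h, MonoidHom.one_apply] at hi
      exact absurd hi (by decide)
    have h := expect_unitsHom (F := ℝ) hχ
    simpa only [χ, MonoidHom.mul_apply, Pi.evalMonoidHom_apply, Units.val_mul, Int.cast_mul]
      using h

theorem expect_signSum_sq (J : Finset I) : 𝔼 ε, signSum J ε ^ 2 = J.card := by
  simp only [signSum, sq, Finset.sum_mul_sum, Finset.expect_sum_comm, expect_sign_mul_sign,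
    Finset.sum_ite_eq, Finset.sum_ite_mem, Finset.inter_self, Finset.sum_const, nsmul_eq_mul,
    mul_one]

theorem expect_norm_sq_sub_le {E : Type*} [SeminormedAddCommGroup E] {F : ℝ → E} {K : ℝ}
    (hF : ∀ x y, ‖F x - F y‖ ≤ K * |x - y|) (J : Finset I) :
    𝔼 ε, ‖F (signSum Finset.univ ε) - F (signSum J ε)‖ ^ 2 ≤ K ^ 2 * (Jᶜ).card := by
  rw [← expect_signSum_sq, Finset.mul_expect]
  refine Finset.expect_le_expect fun ε _ => ?_
  have h := hF (signSum Finset.univ ε) (signSum J ε)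
  rw [signSum_univ_sub] at h
  calc _ ≤ (K * |signSum Jᶜ ε|) ^ 2 := pow_le_pow_left₀ (norm_nonneg _) h 2
    _ = K ^ 2 * signSum Jᶜ ε ^ 2 := by rw [mul_pow, sq_abs]

theorem expect_cexp_signSum (t : ℝ) :
    𝔼 ε : I → ℤˣ, Complex.exp (Complex.I * (t * signSum Finset.univ ε : ℝ)) =
      (Real.cos t : ℂ) ^ Fintype.card I := by
  have hfactor : ∀ ε : I → ℤˣ, Complex.exp (Complex.I * (t * signSum Finset.univ ε : ℝ)) =
      ∏ i, Complex.exp (Complex.I * (t * ((ε i : ℤ) : ℝ) : ℝ)) := fun ε => by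
    rw [signSum, Finset.mul_sum, Complex.ofReal_sum, Finset.mul_sum, Complex.exp_sum]
  have hcos : ∑ s : ℤˣ, Complex.exp (Complex.I * (t * ((s : ℤ) : ℝ) : ℝ)) = 2 * Real.cos t := by
    rw [Complex.ofReal_cos, Complex.two_cos]
    simp [UnitsInt.univ, mul_comm]
  rw [Fintype.expect_eq_sum_div_card]
  simp only [hfactor]
  have hprod := Fintype.prod_sum fun (_ : I) (s : ℤˣ) =>
    Complex.exp (Complex.I * (t * ((s : ℤ) : ℝ) : ℝ))
  rw [← hprod, Finset.prod_const, hcos, Finset.card_univ, mul_pow]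
  simp [Fintype.card_pi]

theorem expect_cos_signSum (t : ℝ) :
    𝔼 ε : I → ℤˣ, Real.cos (t * signSum Finset.univ ε) = Real.cos t ^ Fintype.card I := by
  have hre : ∀ ε : I → ℤˣ, Real.cos (t * signSum Finset.univ ε) =
      (Complex.exp (Complex.I * (t * signSum Finset.univ ε : ℝ))).re := fun ε => by
    rw [mul_comm Complex.I, Complex.exp_ofReal_mul_I_re]
  simp only [hre]
  rw [← Complex.re_expect, expect_cexp_signSum, ← Complex.ofReal_pow, Complex.ofReal_re]

end SignVectors

section Phase

theorem sq_le_two_mul_sq_sin {x : ℝ} (hx : |x| ≤ 1) :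
    x ^ 2 ≤ 2 * Real.sin (Real.pi / 4 * x) ^ 2 := by
  have hconcave : √2 / 2 * |x| ≤ Real.sin (Real.pi / 4 * |x|) := by
    have h := strictConcaveOn_sin_Icc.concaveOn.2 (x := 0) (y := Real.pi / 4)
      ⟨le_rfl, Real.pi_nonneg⟩ ⟨by positivity, by linarith [Real.pi_pos]⟩
      (sub_nonneg.2 hx) (abs_nonneg x) (sub_add_cancel 1 |x|)
    simpa [mul_comm] using h
  have heven : Real.sin (Real.pi / 4 * |x|) ^ 2 = Real.sin (Real.pi / 4 * x) ^ 2 := by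
    rcases abs_choice x with h | h <;> simp [h]
  calc x ^ 2 = 2 * (√2 / 2 * |x|) ^ 2 := by
        rw [mul_pow, div_pow, sq_abs, Real.sq_sqrt zero_le_two]
        ring
    _ ≤ 2 * Real.sin (Real.pi / 4 * x) ^ 2 := by
        rw [← heven]
        gcongr

theorem cos_pi_div_two_mul_sin_le (y : ℝ) :
    Real.cos (Real.pi / 2 * Real.sin y) ≤ Real.cos y ^ 2 := by
  have h := sq_le_two_mul_sq_sin (Real.abs_sin_le_one y)
  rw [show Real.pi / 2 * Real.sin y = 2 * (Real.pi / 4 * Real.sin y) by ring,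
    Real.cos_two_mul_eq_one_sub, Real.cos_sq']
  linarith

theorem cos_pi_mul_sin_le (y : ℝ) :
    Real.cos (Real.pi * Real.sin y) ≤ -1 / 4 + Real.cos (2 * y) + Real.cos (4 * y) / 4 := by
  have hnonneg : 0 ≤ Real.cos (Real.pi / 2 * Real.sin y) :=
    Real.cos_nonneg_of_neg_pi_div_two_le_of_le
      (by nlinarith [Real.neg_one_le_sin y, Real.pi_pos])
      (by nlinarith [Real.sin_le_one y, Real.pi_pos])
  have hsq := pow_le_pow_left₀ hnonneg (cos_pi_div_two_mul_sin_le y) 2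
  rw [show Real.pi * Real.sin y = 2 * (Real.pi / 2 * Real.sin y) by ring,
    show 4 * y = 2 * (2 * y) by ring, Real.cos_two_mul, Real.cos_two_mul (2 * y),
    Real.cos_two_mul y]
  linarith

theorem cos_pi_div_sqrt_nonneg {n : ℕ} (hn : 4 ≤ n) : 0 ≤ Real.cos (Real.pi / √n) := by
  have hsqrt : (2 : ℝ) ≤ √n := Real.le_sqrt_of_sq_le (by norm_num; exact_mod_cast hn)
  have hle : Real.pi / √n ≤ Real.pi / 2 := by gcongr
  exact Real.cos_nonneg_of_neg_pi_div_two_le_of_le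
    ((neg_nonpos.2 Real.pi_div_two_pos.le).trans (by positivity)) hle

theorem cos_pi_div_sqrt_pow_le {n : ℕ} (hn : 4 ≤ n) : Real.cos (Real.pi / √n) ^ n ≤ 1 / 5 := by
  have hn' : (4 : ℝ) ≤ n := by exact_mod_cast hn
  have hle : Real.pi / √n ≤ Real.pi :=
    div_le_self Real.pi_nonneg (Real.one_le_sqrt.2 (by linarith))
  have hcos : Real.cos (Real.pi / √n) ≤ 1 - 2 / n := by
    have h := Real.cos_le_one_sub_mul_cos_sq (x := Real.pi / √n)
      (by rwa [abs_of_nonneg (by positivity)])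
    rw [div_pow, Real.sq_sqrt (Nat.cast_nonneg n)] at h
    refine h.trans_eq ?_
    field_simp
  have hexp : (5 : ℝ) ≤ Real.exp 2 := by
    rw [show (2 : ℝ) = 1 + 1 by norm_num, Real.exp_add]
    nlinarith [Real.exp_one_gt_d9]
  calc Real.cos (Real.pi / √n) ^ n ≤ (1 - 2 / n) ^ n :=
        pow_le_pow_left₀ (cos_pi_div_sqrt_nonneg hn) hcos n
    _ ≤ Real.exp (-2) := Real.one_sub_div_pow_le_exp_neg (by linarith)
    _ ≤ 1 / 5 := by
        rw [Real.exp_neg, ← one_div]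
        gcongr

/-- The phase factor `exp(i s sin(t x))`. For `s = 0` it is constant, while for `s = π` it takes
the opposite values `1` at `x = 0` and `-1` at `|x| = π / (2 t)`; varying `s` in between lets its
expectation be tuned to zero. -/
noncomputable def phase (s t x : ℝ) : ℂ := Complex.exp (Complex.I * (s * Real.sin (t * x) : ℝ))

theorem norm_phase (s t x : ℝ) : ‖phase s t x‖ = 1 := by
  rw [phase, mul_comm, Complex.norm_exp_ofReal_mul_I]

theorem norm_phase_sub_le (s t x y : ℝ) : ‖phase s t x - phase s t y‖ ≤ |s| * |t| * |x - y| := by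
  have hsplit : phase s t x - phase s t y = phase s t y *
      (Complex.exp (Complex.I * (s * (Real.sin (t * x) - Real.sin (t * y)) : ℝ)) - 1) := by
    rw [phase, phase, mul_sub, mul_one, ← Complex.exp_add]
    push_cast
    ring_nf
  rw [hsplit, norm_mul, norm_phase, one_mul]
  refine Real.norm_exp_I_mul_ofReal_sub_one_le.trans ?_
  calc ‖s * (Real.sin (t * x) - Real.sin (t * y))‖
      = |s| * |Real.sin (t * x) - Real.sin (t * y)| := by rw [Real.norm_eq_abs, abs_mul]
    _ ≤ |s| * |t * x - t * y| :=
        mul_le_mul_of_nonneg_left (Real.abs_sin_sub_sin_le _ _) (abs_nonneg s)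
    _ = |s| * |t| * |x - y| := by rw [← mul_sub, abs_mul, mul_assoc]

variable {I : Type*} [Fintype I] [DecidableEq I]

theorem expect_phase_signSum (s t : ℝ) :
    𝔼 ε : I → ℤˣ, phase s t (signSum Finset.univ ε) =
      (𝔼 ε : I → ℤˣ, Real.cos (s * Real.sin (t * signSum Finset.univ ε)) : ℝ) := by
  have hsin : 𝔼 ε : I → ℤˣ, Real.sin (s * Real.sin (t * signSum Finset.univ ε)) = 0 :=
    expect_eq_zero_of_odd fun ε => by simp only [signSum_neg, mul_neg, Real.sin_neg]
  refine Complex.ext ?_ ?_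
  · simp only [Complex.re_expect, phase, mul_comm Complex.I, Complex.exp_ofReal_mul_I_re,
      Complex.ofReal_re]
  · simpa only [Complex.im_expect, phase, mul_comm Complex.I, Complex.exp_ofReal_mul_I_im,
      Complex.ofReal_im] using hsin

theorem expect_cos_pi_mul_sin_nonpos (hI : 16 ≤ Fintype.card I) :
    𝔼 ε : I → ℤˣ, Real.cos (Real.pi *
      Real.sin (Real.pi / (2 * √(Fintype.card I)) * signSum Finset.univ ε)) ≤ 0 := by
  set n := Fintype.card I
  set t := Real.pi / (2 * √n) with ht
  have h2t : 2 * t = Real.pi / √n := by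
    rw [ht]
    field_simp
  have h4t : 0 ≤ Real.cos (4 * t) ∧ Real.cos (4 * t) ≤ Real.cos (2 * t) := by
    have hsqrt : (4 : ℝ) ≤ √n := Real.le_sqrt_of_sq_le (by norm_num; exact_mod_cast hI)
    have h4 : 4 * t ≤ Real.pi / 2 := by
      rw [show 4 * t = 2 * (2 * t) by ring, h2t]
      have : Real.pi / √n ≤ Real.pi / 4 := by gcongr
      linarith
    have h0 : 0 ≤ t := by positivity
    exact ⟨Real.cos_nonneg_of_neg_pi_div_two_le_of_le (by linarith [Real.pi_pos]) h4,
      Real.cos_le_cos_of_nonneg_of_le_pi (by linarith) (by linarith [Real.pi_pos]) (by linarith)⟩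
  have hpow2 : Real.cos (2 * t) ^ n ≤ 1 / 5 := h2t ▸ cos_pi_div_sqrt_pow_le (by omega)
  have hpow4 : Real.cos (4 * t) ^ n ≤ 1 / 5 := (pow_le_pow_left₀ h4t.1 h4t.2 n).trans hpow2
  have hpoint : 𝔼 ε : I → ℤˣ, Real.cos (Real.pi * Real.sin (t * signSum Finset.univ ε)) ≤
      𝔼 ε : I → ℤˣ, (-1 / 4 + Real.cos (2 * t * signSum Finset.univ ε) +
        Real.cos (4 * t * signSum Finset.univ ε) / 4) :=
    Finset.expect_le_expect fun ε _ => by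
      simpa only [mul_assoc] using cos_pi_mul_sin_le (t * signSum Finset.univ ε)
  rw [Finset.expect_add_distrib, Finset.expect_add_distrib, Fintype.expect_const,
    ← Finset.expect_div, expect_cos_signSum, expect_cos_signSum] at hpoint
  linarith

theorem exists_expect_phase_signSum_eq_zero (hI : 16 ≤ Fintype.card I) :
    ∃ s ∈ Set.Icc 0 Real.pi, 𝔼 ε : I → ℤˣ,
      phase s (Real.pi / (2 * √(Fintype.card I))) (signSum Finset.univ ε) = 0 := by
  have hcont : Continuous fun s : ℝ => 𝔼 ε : I → ℤˣ, Real.cos (s *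
      Real.sin (Real.pi / (2 * √(Fintype.card I)) * signSum Finset.univ ε)) := by
    simp only [Fintype.expect_eq_sum_div_card]
    fun_prop
  have hzero : (0 : ℝ) ∈ Set.Icc _ _ := ⟨expect_cos_pi_mul_sin_nonpos hI, show (0 : ℝ) ≤
      𝔼 ε : I → ℤˣ, Real.cos (0 * Real.sin (Real.pi / (2 * √(Fintype.card I)) *
        signSum Finset.univ ε)) by
    simp only [zero_mul, Real.cos_zero, Fintype.expect_const, zero_le_one]⟩
  obtain ⟨s, hs, hs0⟩ := intermediate_value_Icc' Real.pi_nonneg hcont.continuousOn hzero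
  refine ⟨s, hs, ?_⟩
  rw [expect_phase_signSum, Complex.ofReal_eq_zero]
  exact hs0

end Phase

/-! ### Functional calculus of commuting symmetries -/

section SignCalculus

variable {I : Type*} [Fintype I]

/-- The bicharacter of `ℤˣ`, written multiplicatively: it takes the value `-1` only at
`(-1, -1)`. -/
def signPairing : ℤˣ →* ℤˣ →* ℤˣ :=
  MonoidHom.mk' (fun a => MonoidHom.mk' (fun b => if a = -1 then b else 1) (by decide +revert))
    (by decide)

/-- The Walsh characters `ε ↦ ∏ i with v i = -1, ε i`, as a self-duality of `I → ℤˣ`. -/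
def walsh : (I → ℤˣ) →* (I → ℤˣ) →* ℤˣ :=
  ∏ i, (signPairing.comp (Pi.evalMonoidHom (fun _ => ℤˣ) i)).compl₂
    (Pi.evalMonoidHom (fun _ => ℤˣ) i)

theorem walsh_apply (v ε : I → ℤˣ) : walsh v ε = ∏ i, signPairing (v i) (ε i) := by
  simp [walsh]

theorem walsh_comm (v ε : I → ℤˣ) : walsh v ε = walsh ε v := by
  have hcomm : ∀ a b : ℤˣ, signPairing a b = signPairing b a := by decide
  simp only [walsh_apply, hcomm (v _)]

theorem walsh_mulSingle [DecidableEq I] (i : I) (ε : I → ℤˣ) :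
    walsh (Pi.mulSingle i (-1)) ε = ε i := by
  have hneg : ∀ b : ℤˣ, signPairing (-1) b = b := by decide
  rw [walsh_apply, Fintype.prod_eq_single i fun j hj => by
    rw [Pi.mulSingle_eq_of_ne hj, map_one, MonoidHom.one_apply], Pi.mulSingle_eq_same, hneg]

theorem walsh_injective : Function.Injective (walsh : (I → ℤˣ) →* _) :=
  fun v w h => funext fun i => by
    classical
    rw [← walsh_mulSingle i v, ← walsh_mulSingle i w, walsh_comm, h, walsh_comm]

variable [DecidableEq I]

theorem sum_walsh (v : I → ℤˣ) :
    ∑ ε, ((walsh v ε : ℤ) : ℂ) = if v = 1 then (Fintype.card (I → ℤˣ) : ℂ) else 0 := by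
  split_ifs with hv
  · simp [hv]
  · have h := expect_unitsHom (F := ℂ) ((map_ne_one_iff walsh walsh_injective).2 hv)
    rw [Fintype.expect_eq_sum_div_card, div_eq_zero_iff] at h
    exact h.resolve_right (Nat.cast_ne_zero.2 Fintype.card_ne_zero)

variable {A : Type*} [Ring A] [StarRing A] [Algebra ℂ A]

/-- The joint spectral projection of the commuting symmetries `u v` onto the joint eigenspace with
eigenvalues `walsh v ε`. -/
noncomputable def signProjection (u : (I → ℤˣ) →* unitary A) (ε : I → ℤˣ) : A :=
  (Fintype.card (I → ℤˣ) : ℂ)⁻¹ • ∑ v, ((walsh v ε : ℤ) : ℂ) • (u v : A)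

variable (u : (I → ℤˣ) →* unitary A)

theorem mul_signProjection (v ε : I → ℤˣ) :
    (u v : A) * signProjection u ε = ((walsh v ε : ℤ) : ℂ) • signProjection u ε := by
  rw [signProjection, mul_smul_comm, Finset.mul_sum, smul_comm]
  congr 1
  rw [Finset.smul_sum]
  refine Fintype.sum_equiv (Equiv.mulLeft v) _ _ fun w => ?_
  have hsq : (walsh v ε * walsh v ε : ℤˣ) = 1 := Int.units_mul_self _
  rw [Equiv.coe_mulLeft, smul_smul, ← Int.cast_mul, ← Units.val_mul, map_mul,
    MonoidHom.mul_apply, ← mul_assoc, hsq, one_mul, mul_smul_comm, map_mul]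
  rfl

theorem signProjection_mul_signProjection (ε ε' : I → ℤˣ) :
    signProjection u ε * signProjection u ε' = if ε = ε' then signProjection u ε' else 0 := by
  have hcoeff : ∀ v, ((walsh v ε : ℤ) : ℂ) * ((walsh v ε' : ℤ) : ℂ) =
      ((walsh (ε * ε') v : ℤ) : ℂ) := fun v => by
    rw [walsh_comm _ v, map_mul, Units.val_mul, Int.cast_mul]
  have hone : ε * ε' = 1 ↔ ε = ε' := by
    rw [mul_eq_one_iff_eq_inv]
    simp [funext_iff]
  conv_lhs => rw [signProjection]
  simp only [smul_mul_assoc, Finset.sum_mul, mul_signProjection, smul_smul, hcoeff,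
    ← Finset.sum_smul, sum_walsh, hone]
  split_ifs
  · rw [inv_mul_cancel₀ (Nat.cast_ne_zero.2 Fintype.card_ne_zero), one_smul]
  · rw [mul_zero, zero_smul]

theorem sum_signProjection : ∑ ε, signProjection u ε = 1 := by
  simp only [signProjection]
  rw [← Finset.smul_sum, Finset.sum_comm]
  simp only [← Finset.sum_smul, sum_walsh, ite_smul, zero_smul, Finset.sum_ite_eq',
    Finset.mem_univ, if_true, map_one, OneMemClass.coe_one]
  rw [inv_smul_smul₀ (Nat.cast_ne_zero.2 Fintype.card_ne_zero)]

variable [StarModule ℂ A]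

theorem star_signProjection (ε : I → ℤˣ) :
    star (signProjection u ε) = signProjection u ε := by
  have hstar : ∀ v, star (u v : A) = u v := fun v => by
    rw [← Unitary.coe_star, Unitary.star_eq_inv, ← map_inv,
      show v⁻¹ = v from funext fun i => Int.units_inv_eq_self _]
  simp [signProjection, star_smul, star_sum, hstar]

/-- The functional calculus of the commuting symmetries `u v`: the signs `ε i` are replaced by the
symmetries `u (Pi.mulSingle i (-1))`. -/
noncomputable def signCalculus : ((I → ℤˣ) → ℂ) →⋆ₐ[ℂ] A where
  __ := AlgHom.ofLinearMap (Fintype.linearCombination ℂ (signProjection u))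
    (by simpa [Fintype.linearCombination_apply] using sum_signProjection u)
    fun f g => by
      simp [Fintype.linearCombination_apply, Finset.sum_mul_sum,
        signProjection_mul_signProjection, smul_smul, mul_comm]
  map_star' f := by
    simp [Fintype.linearCombination_apply, star_sum, star_smul, star_signProjection]

theorem signCalculus_apply (f : (I → ℤˣ) → ℂ) :
    signCalculus u f = ∑ ε, f ε • signProjection u ε :=
  rfl

theorem signCalculus_walsh (v : I → ℤˣ) :
    signCalculus u (fun ε => ((walsh v ε : ℤ) : ℂ)) = u v := by
  simp only [signCalculus_apply, ← mul_signProjection]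
  rw [← Finset.mul_sum, sum_signProjection, mul_one]

theorem signCalculus_signSum (J : Finset I) :
    signCalculus u (fun ε => (signSum J ε : ℂ)) = ∑ i ∈ J, (u (Pi.mulSingle i (-1)) : A) := by
  have hsum : (fun ε : I → ℤˣ => (signSum J ε : ℂ)) =
      ∑ i ∈ J, fun ε => ((walsh (Pi.mulSingle i (-1)) ε : ℤ) : ℂ) := by
    ext ε
    simp [signSum, walsh_mulSingle]
  simp only [hsum, map_sum, signCalculus_walsh]

theorem signCalculus_mem_unitary {f : (I → ℤˣ) → ℂ} (hf : ∀ ε, ‖f ε‖ = 1) :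
    signCalculus u f ∈ unitary A := by
  refine Unitary.map_mem (signCalculus u) ?_
  have hconj : ∀ ε, star (f ε) * f ε = 1 := fun ε => by
    rw [Complex.star_def, ← Complex.normSq_eq_conj_mul_self, Complex.normSq_eq_norm_sq, hf]
    norm_num
  exact Unitary.mem_iff.2 ⟨funext hconj, funext fun ε => (mul_comm _ _).trans (hconj ε)⟩

end SignCalculus

section AlgebraHom

variable {k Ω Ω' : Type*} [Field k]

theorem aeval_pi_eq_comp {F : k → k} {p : Polynomial k} {a : Ω → k}
    (h : ∀ ω, p.eval (a ω) = F (a ω)) : Polynomial.aeval a p = F ∘ a := by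
  ext ω
  rw [Polynomial.aeval_fn_apply, Polynomial.coe_aeval_eq_eval, h, Function.comp_apply]

theorem map_comp_eq_map_comp {A : Type*} [Ring A] [Algebra k A] [Finite Ω] [Finite Ω']
    {Φ : (Ω → k) →ₐ[k] A} {Ψ : (Ω' → k) →ₐ[k] A} {a : Ω → k} {b : Ω' → k}
    (h : Φ a = Ψ b) (F : k → k) : Φ (F ∘ a) = Ψ (F ∘ b) := by
  classical
  -- On the finitely many values of `a` and `b`, the function `F` is a polynomial.
  obtain ⟨s, hs⟩ := ((Set.finite_range a).union (Set.finite_range b)).exists_finset_coe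
  have hnode : ∀ x ∈ s, (Lagrange.interpolate s id F).eval x = F x := fun x hx =>
    Lagrange.eval_interpolate_at_node F Function.injective_id.injOn hx
  rw [← aeval_pi_eq_comp fun ω => hnode (a ω) (by simp [← Finset.mem_coe, hs]),
    ← aeval_pi_eq_comp fun ω => hnode (b ω) (by simp [← Finset.mem_coe, hs]),
    ← Polynomial.aeval_algHom_apply, ← Polynomial.aeval_algHom_apply, h]

end AlgebraHom

/-! ### Group von Neumann algebras of ICC groups -/

local notation "ℓ²(" G ")" => lp (fun _ : G => ℂ) 2

section Regular

variable {G : Type*}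

open Classical in
/-- The basis vector of `ℓ²(G)` at `g`. -/
noncomputable def basisVector (g : G) : ℓ²(G) := lp.single 2 g 1

theorem basisVector_apply_self (g : G) : basisVector g g = 1 := by
  classical
  exact lp.single_apply_self 2 g _

theorem basisVector_apply_ne {g h : G} (hne : h ≠ g) : basisVector g h = 0 := by
  classical
  exact lp.single_apply_ne 2 g _ hne

theorem inner_basisVector_left (g : G) (f : ℓ²(G)) :
    inner ℂ (basisVector g) f = f g := by
  classical
  rw [basisVector, lp.inner_single_left]
  simp

theorem inner_basisVector_right (g : G) (f : ℓ²(G)) :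
    inner ℂ f (basisVector g) = star (f g) := by
  rw [← inner_conj_symm, inner_basisVector_left]
  rfl

theorem orthonormal_basisVector : Orthonormal ℂ (basisVector : G → ℓ²(G)) := by
  classical
  rw [orthonormal_iff_ite]
  intro g h
  rw [inner_basisVector_left]
  split_ifs with hgh
  · rw [hgh, basisVector_apply_self]
  · exact basisVector_apply_ne hgh

theorem hasSum_basisVector (f : ℓ²(G)) :
    HasSum (fun g => f g • basisVector g) f := by
  classical
  have h := lp.hasSum_single (p := 2) (by norm_num) f
  convert! h using 2 with g
  rw [basisVector, ← lp.single_smul, smul_eq_mul, mul_one]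

variable [Group G]

/-- The right regular representation on `ℓ²(G)`: `(ρ_g f)(h) = f(h g)`. -/
noncomputable def rightRegular (g : G) : ℓ²(G) →ₗᵢ[ℂ] ℓ²(G) where
  toFun f := ⟨fun h => f (h * g), memℓp_gen
    ((Equiv.mulRight g).summable_iff.2 ((lp.memℓp f).summable (by norm_num)))⟩
  map_add' _ _ := rfl
  map_smul' _ _ := rfl
  norm_map' f := by
    rw [lp.norm_eq_tsum_rpow (by norm_num), lp.norm_eq_tsum_rpow (by norm_num)]
    exact congrArg (· ^ _) ((Equiv.mulRight g).tsum_eq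
      (fun h => ‖f h‖ ^ (2 : ENNReal).toReal))

theorem leftRegular_apply (g h : G) (f : ℓ²(G)) :
    leftRegular g f h = f (g⁻¹ * h) :=
  rfl

theorem rightRegular_apply (g h : G) (f : ℓ²(G)) :
    rightRegular g f h = f (h * g) :=
  rfl

theorem leftRegular_basisVector (g h : G) :
    leftRegular g (basisVector h) = basisVector (g * h) := by
  ext k
  rw [leftRegular_apply]
  by_cases hk : k = g * h
  · rw [hk, inv_mul_cancel_left, basisVector_apply_self, basisVector_apply_self]
  · rw [basisVector_apply_ne hk, basisVector_apply_ne]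
    rintro rfl
    exact hk (mul_inv_cancel_left _ _).symm

theorem rightRegular_basisVector (g h : G) :
    rightRegular g (basisVector h) = basisVector (h * g⁻¹) := by
  ext k
  rw [rightRegular_apply]
  by_cases hk : k = h * g⁻¹
  · rw [hk, inv_mul_cancel_right, basisVector_apply_self, basisVector_apply_self]
  · rw [basisVector_apply_ne hk, basisVector_apply_ne]
    rintro rfl
    exact hk (mul_inv_cancel_right _ _).symm

theorem star_leftRegular (g : G) :
    star (leftRegular g).toContinuousLinearMap = (leftRegular g⁻¹).toContinuousLinearMap := by
  rw [ContinuousLinearMap.star_eq_adjoint, eq_comm, ContinuousLinearMap.eq_adjoint_iff]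
  intro x y
  change inner ℂ (leftRegular g⁻¹ x) y = inner ℂ x (leftRegular g y)
  rw [← (leftRegular g).inner_map_map]
  congr 1
  ext h
  rw [leftRegular_apply, leftRegular_apply, inv_inv, mul_inv_cancel_left]

theorem leftRegular_mem (g : G) :
    (leftRegular g).toContinuousLinearMap ∈ (groupVonNeumannAlgebra G).toStarSubalgebra := by
  change _ ∈ StarSubalgebra.centralizer ℂ _
  rw [StarSubalgebra.mem_centralizer_iff]
  intro a ha
  have ha' := (StarSubalgebra.mem_centralizer_iff ℂ).1 ha
  have ha'' := (StarSubalgebra.mem_centralizer_iff ℂ).1 (star_mem ha)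
  exact ⟨(ha' _ ⟨g, rfl⟩).1.symm, (ha'' _ ⟨g, rfl⟩).1.symm⟩

theorem rightRegular_mem_centralizer (g : G) :
    (rightRegular g).toContinuousLinearMap ∈ StarSubalgebra.centralizer ℂ
      (Set.range fun g : G => (leftRegular g).toContinuousLinearMap) := by
  rw [StarSubalgebra.mem_centralizer_iff]
  have hcomm : ∀ h : G,
      (leftRegular h).toContinuousLinearMap * (rightRegular g).toContinuousLinearMap =
      (rightRegular g).toContinuousLinearMap * (leftRegular h).toContinuousLinearMap := by
    intro h
    ext f k
    change f (h⁻¹ * k * g) = f (h⁻¹ * (k * g))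
    rw [mul_assoc]
  rintro _ ⟨h, rfl⟩
  refine ⟨hcomm h, ?_⟩
  rw [star_leftRegular]
  exact hcomm h⁻¹

end Regular

section GroupAlgebra

/-- The group von Neumann algebra as a star algebra in its own right. -/
abbrev GroupVN (G : Type*) [Group G] : Type _ := (groupVonNeumannAlgebra G).toStarSubalgebra

variable {G : Type*} [Group G]

/-- The canonical unitaries `λ_g` of the group von Neumann algebra. -/
noncomputable def canonicalUnitary : G →* GroupVN G where
  toFun g := ⟨(leftRegular g).toContinuousLinearMap, leftRegular_mem g⟩
  map_one' := by
    ext f h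
    change f (1⁻¹ * h) = f h
    rw [inv_one, one_mul]
  map_mul' g k := by
    ext f h
    change f ((g * k)⁻¹ * h) = f (k⁻¹ * (g⁻¹ * h))
    rw [mul_inv_rev, mul_assoc]

theorem canonicalUnitary_mem_unitary (g : G) : canonicalUnitary g ∈ unitary (GroupVN G) := by
  have hstar : star (canonicalUnitary g) = canonicalUnitary g⁻¹ := Subtype.ext (star_leftRegular g)
  rw [Unitary.mem_iff, hstar, ← map_mul, ← map_mul, inv_mul_cancel, mul_inv_cancel, map_one]
  exact ⟨rfl, rfl⟩

/-- The vector `a δ₁` of an element `a` of the group von Neumann algebra. Its norm is `‖a‖₂`. -/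
noncomputable def traceVector : GroupVN G →ₗ[ℂ] ℓ²(G) where
  toFun a := (a : ℓ²(G) →L[ℂ] ℓ²(G)) (basisVector 1)
  map_add' _ _ := rfl
  map_smul' _ _ := rfl

theorem traceVector_mul (a b : GroupVN G) :
    traceVector (a * b) =
      (a : ℓ²(G) →L[ℂ] ℓ²(G)) (traceVector b) :=
  rfl

theorem traceVector_one : traceVector (1 : GroupVN G) = basisVector 1 :=
  rfl

theorem traceVector_canonicalUnitary (g : G) : traceVector (canonicalUnitary g) = basisVector g :=
  (leftRegular_basisVector g 1).trans (by rw [mul_one])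

theorem traceVector_canonicalUnitary_mul (g : G) (a : GroupVN G) :
    traceVector (canonicalUnitary g * a) = leftRegular g (traceVector a) :=
  rfl

theorem apply_rightRegular (a : GroupVN G) (g : G) (f : ℓ²(G)) :
    (a : ℓ²(G) →L[ℂ] ℓ²(G)) (rightRegular g f) =
      rightRegular g ((a : ℓ²(G) →L[ℂ] ℓ²(G)) f) := by
  have h := ((StarSubalgebra.mem_centralizer_iff ℂ).1 a.2 _ (rightRegular_mem_centralizer g)).1
  exact (DFunLike.congr_fun h f).symm

theorem apply_basisVector (a : GroupVN G) (g : G) :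
    (a : ℓ²(G) →L[ℂ] ℓ²(G)) (basisVector g) =
      rightRegular g⁻¹ (traceVector a) := by
  have h := rightRegular_basisVector g⁻¹ 1
  rw [inv_inv, one_mul] at h
  rw [← h, apply_rightRegular]
  rfl

theorem traceVector_mul_canonicalUnitary (a : GroupVN G) (g : G) :
    traceVector (a * canonicalUnitary g) = rightRegular g⁻¹ (traceVector a) := by
  rw [traceVector_mul, traceVector_canonicalUnitary, apply_basisVector]

theorem traceVector_injective : Function.Injective (traceVector : GroupVN G → _) := by
  intro a b hab
  refine Subtype.ext (ContinuousLinearMap.ext fun f => ?_)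
  have ha := (hasSum_basisVector f).mapL (a : ℓ²(G) →L[ℂ] ℓ²(G))
  have hb := (hasSum_basisVector f).mapL (b : ℓ²(G) →L[ℂ] ℓ²(G))
  simp only [map_smul, apply_basisVector] at ha hb
  rw [hab] at ha
  exact ha.unique hb

theorem inner_apply_left (a : GroupVN G) (x y : ℓ²(G)) :
    inner ℂ (((star a : GroupVN G) : ℓ²(G) →L[ℂ] ℓ²(G)) x) y =
      inner ℂ x ((a : ℓ²(G) →L[ℂ] ℓ²(G)) y) :=
  ContinuousLinearMap.adjoint_inner_left _ _ _

theorem traceVector_star_apply (a : GroupVN G) (g : G) :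
    traceVector (star a) g = star (traceVector a g⁻¹) := by
  have h := inner_apply_left a (basisVector 1) (basisVector g)
  rw [inner_basisVector_right, inner_basisVector_left, apply_basisVector a, rightRegular_apply,
    one_mul] at h
  rw [← h, star_star]
  rfl

theorem groupTrace_eq (a : GroupVN G) : groupTrace G a = traceVector a 1 :=
  inner_basisVector_left 1 _

theorem groupTrace_mul (a b : GroupVN G) :
    groupTrace G (a * b) = inner ℂ (traceVector (star a)) (traceVector b) := by
  rw [groupTrace_eq, traceVector_mul, ← inner_basisVector_left, ← inner_apply_left]
  rfl

theorem groupTrace_star_mul_self (a : GroupVN G) :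
    groupTrace G (star a * a) = ((‖traceVector a‖ ^ 2 : ℝ) : ℂ) := by
  rw [groupTrace_mul, star_star, inner_self_eq_norm_sq_to_K]
  push_cast
  rfl

theorem traceNorm_groupTrace (a : GroupVN G) :
    traceNorm (groupVonNeumannAlgebra G) (groupTrace G) a = ‖traceVector a‖ := by
  rw [traceNorm, groupTrace_star_mul_self, Complex.ofReal_re, Real.sqrt_sq (norm_nonneg _)]

theorem groupTrace_mul_comm (a b : GroupVN G) :
    groupTrace G (a * b) = groupTrace G (b * a) := by
  have h : ∀ a b : GroupVN G,
      groupTrace G (a * b) = ∑' g, traceVector a g⁻¹ * traceVector b g := by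
    intro a b
    rw [groupTrace_mul, lp.inner_eq_tsum]
    refine tsum_congr fun g => ?_
    rw [traceVector_star_apply, RCLike.inner_apply]
    simp [mul_comm]
  rw [h, h, ← (Equiv.inv G).tsum_eq]
  refine tsum_congr fun g => ?_
  simp [mul_comm]

theorem isFaithfulNormalTracialState_groupTrace :
    IsFaithfulNormalTracialState (groupVonNeumannAlgebra G) (groupTrace G) where
  map_one := by rw [groupTrace_eq, traceVector_one, basisVector_apply_self]
  nonneg a := by
    rw [groupTrace_star_mul_self]
    exact ⟨by rw [Complex.ofReal_re]; positivity, Complex.ofReal_im _⟩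
  faithful a h := by
    rw [groupTrace_star_mul_self] at h
    refine traceVector_injective ?_
    rw [map_zero]
    simpa using h
  tracial := groupTrace_mul_comm
  normal := by
    have hsummable : Summable fun n : ℕ =>
        ‖(Pi.single 0 (basisVector 1) : ℕ → ℓ²(G)) n‖ ^ 2 :=
      summable_of_ne_finset_zero (s := {0}) fun n hn => by
        rw [Pi.single_eq_of_ne (by simpa using hn), norm_zero, sq, zero_mul]
    refine ⟨_, _, hsummable, hsummable, fun a => hasSum_single (0 : ℕ) fun n hn => ?_⟩
    rw [Pi.single_eq_of_ne hn, inner_zero_left]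

theorem IsICC.eq_zero_of_conj_invariant (hG : IsICC G) {f : ℓ²(G)}
    (hf : ∀ g h, f (g * h * g⁻¹) = f h) {h : G} (hh : h ≠ 1) : f h = 0 := by
  by_contra hne
  have hsum := (lp.memℓp f).summable (by norm_num)
  have hlt := hsum.tendsto_cofinite_zero.eventually
    (gt_mem_nhds (show 0 < ‖f h‖ ^ (2 : ENNReal).toReal by positivity))
  refine hG h hh (Set.Finite.subset hlt fun k hk => ?_)
  obtain ⟨g, rfl⟩ := isConj_iff.1 hk
  change ¬ (‖f (g * h * g⁻¹)‖ ^ (2 : ENNReal).toReal < _)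
  rw [hf]
  exact lt_irrefl _

theorem traceVector_conj_apply {z : GroupVN G} (hz : ∀ g, Commute (canonicalUnitary g) z)
    (g h : G) : traceVector z (g * h * g⁻¹) = traceVector z h := by
  have hcomm := congrArg (fun a => traceVector a (g * h)) (hz g).eq
  simp only [traceVector_canonicalUnitary_mul, traceVector_mul_canonicalUnitary,
    leftRegular_apply, rightRegular_apply, inv_mul_cancel_left] at hcomm
  exact hcomm.symm

theorem IsICC.isFactor (hG : IsICC G) : IsFactor (groupVonNeumannAlgebra G) := by
  intro z hz hz'
  let z' : GroupVN G := ⟨z, hz⟩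
  have hcomm : ∀ g, Commute (canonicalUnitary g) z' := fun g =>
    Subtype.ext (VonNeumannAlgebra.mem_commutant_iff.1 hz' _ (leftRegular_mem g))
  have hscalar : z' = traceVector z' 1 • (1 : GroupVN G) := by
    refine traceVector_injective ?_
    rw [map_smul, traceVector_one]
    ext h
    rw [lp.coeFn_smul, Pi.smul_apply, smul_eq_mul]
    by_cases hh : h = 1
    · rw [hh, basisVector_apply_self, mul_one]
    · rw [hG.eq_zero_of_conj_invariant (traceVector_conj_apply hcomm) hh,
        basisVector_apply_ne hh, mul_zero]
  exact ⟨traceVector z' 1, congrArg Subtype.val hscalar⟩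

theorem not_finiteDimensional_groupVN [Infinite G] : ¬ FiniteDimensional ℂ (GroupVN G) := by
  intro hfin
  have h : LinearIndependent ℂ (canonicalUnitary : G → GroupVN G) := by
    refine LinearIndependent.of_comp traceVector ?_
    rw [show traceVector ∘ (canonicalUnitary : G → GroupVN G) = basisVector from
      funext traceVector_canonicalUnitary]
    exact orthonormal_basisVector.linearIndependent
  exact Infinite.not_finite h.finite_of_isNoetherian

theorem IsICC.isIIOneFactor [Infinite G] (hG : IsICC G) :
    IsIIOneFactor (groupVonNeumannAlgebra G) (groupTrace G) :=
  ⟨hG.isFactor, not_finiteDimensional_groupVN, isFaithfulNormalTracialState_groupTrace⟩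

theorem norm_traceVector_unitary_mul {u : GroupVN G} (hu : u ∈ unitary (GroupVN G))
    (a : GroupVN G) : ‖traceVector (u * a)‖ = ‖traceVector a‖ := by
  rw [← traceNorm_groupTrace, ← traceNorm_groupTrace, traceNorm, traceNorm, star_mul, mul_assoc,
    ← mul_assoc (star u), Unitary.star_mul_self_of_mem hu, one_mul]

theorem norm_traceVector_mul_unitary {u : GroupVN G} (hu : u ∈ unitary (GroupVN G))
    (a : GroupVN G) : ‖traceVector (a * u)‖ = ‖traceVector a‖ := by
  rw [← traceNorm_groupTrace, ← traceNorm_groupTrace, traceNorm, traceNorm, star_mul, mul_assoc,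
    groupTrace_mul_comm, mul_assoc, mul_assoc, Unitary.mul_star_self_of_mem hu, mul_one]

theorem exists_norm_traceVector_sub_lt (a : GroupVN G) {ε : ℝ} (hε : 0 < ε) :
    ∃ (s : Finset G) (c : G → ℂ),
      ‖traceVector (a - ∑ g ∈ s, c g • canonicalUnitary g)‖ < ε := by
  obtain ⟨s, hs⟩ := ((hasSum_basisVector (traceVector a)).eventually
    (Metric.ball_mem_nhds _ hε)).exists
  refine ⟨s, traceVector a, ?_⟩
  rw [map_sub, map_sum]
  simp only [map_smul, traceVector_canonicalUnitary]
  rw [← dist_eq_norm, dist_comm]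
  exact hs

theorem norm_traceVector_commutator_sum_le (u : GroupVN G) (s : Finset G) (c : G → ℂ) {η : ℝ}
    (h : ∀ g ∈ s, ‖traceVector (canonicalUnitary g * u - u * canonicalUnitary g)‖ < η) :
    ‖traceVector ((∑ g ∈ s, c g • canonicalUnitary g) * u -
      u * ∑ g ∈ s, c g • canonicalUnitary g)‖ ≤ (∑ g ∈ s, ‖c g‖) * η := by
  have hexp : (∑ g ∈ s, c g • canonicalUnitary g) * u - u * ∑ g ∈ s, c g • canonicalUnitary g =
      ∑ g ∈ s, c g • (canonicalUnitary g * u - u * canonicalUnitary g) := by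
    simp only [Finset.sum_mul, Finset.mul_sum, ← Finset.sum_sub_distrib, smul_sub,
      smul_mul_assoc, mul_smul_comm]
  rw [hexp, map_sum, Finset.sum_mul]
  refine (norm_sum_le _ _).trans (Finset.sum_le_sum fun g hg => ?_)
  rw [map_smul, norm_smul]
  exact mul_le_mul_of_nonneg_left (h g hg).le (norm_nonneg _)

theorem norm_traceVector_commutator_le {u : GroupVN G} (hu : u ∈ unitary (GroupVN G))
    (a b : GroupVN G) : ‖traceVector (a * u - u * a)‖ ≤
      2 * ‖traceVector (a - b)‖ + ‖traceVector (b * u - u * b)‖ := by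
  have hsplit : a * u - u * a = (a - b) * u - u * (a - b) + (b * u - u * b) := by
    rw [sub_mul, mul_sub]
    abel
  rw [hsplit, map_add, map_sub]
  refine (norm_add_le _ _).trans (add_le_add_left ((norm_sub_le _ _).trans ?_) _)
  rw [norm_traceVector_mul_unitary hu, norm_traceVector_unitary_mul hu, two_mul]

theorem IsICC.hasPropertyGamma [Infinite G] (hG : IsICC G)
    (h : ∀ (S : Finset G) (ε : ℝ), 0 < ε → ∃ u ∈ unitary (GroupVN G), groupTrace G u = 0 ∧
      ∀ g ∈ S, ‖traceVector (canonicalUnitary g * u - u * canonicalUnitary g)‖ < ε) :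
    HasPropertyGamma G := by
  classical
  refine ⟨hG, hG.isIIOneFactor, fun ε hε Ω => ?_⟩
  choose s c hc using fun a : GroupVN G =>
    exists_norm_traceVector_sub_lt a (show 0 < ε / 4 by positivity)
  let K : ℝ := ∑ a ∈ Ω, ∑ g ∈ s a, ‖c a g‖
  have hK : 0 ≤ K := Finset.sum_nonneg fun _ _ => Finset.sum_nonneg fun _ _ => norm_nonneg _
  have hη : 0 < ε / (4 * (K + 1)) := by positivity
  obtain ⟨u, hu, hu0, hcomm⟩ := h (Ω.biUnion s) _ hη
  refine ⟨u, hu, hu0, fun a ha => ?_⟩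
  rw [traceNorm_groupTrace]
  have happrox := norm_traceVector_commutator_le hu a (∑ g ∈ s a, c a g • canonicalUnitary g)
  have hsum := norm_traceVector_commutator_sum_le u (s a) (c a)
    fun g hg => hcomm g (Finset.mem_biUnion.2 ⟨a, ha, hg⟩)
  have hcoeff : ∑ g ∈ s a, ‖c a g‖ ≤ K + 1 :=
    (Finset.single_le_sum (f := fun a => ∑ g ∈ s a, ‖c a g‖)
      (fun _ _ => Finset.sum_nonneg fun _ _ => norm_nonneg _) ha).trans (by linarith)
  have hsmall : (∑ g ∈ s a, ‖c a g‖) * (ε / (4 * (K + 1))) ≤ ε / 4 :=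
    (mul_le_mul_of_nonneg_right hcoeff hη.le).trans_eq (by field_simp)
  linarith [hc a]

end GroupAlgebra

/-! ### Property Gamma from permuted involutions -/

section GroupCalculus

variable {G : Type*} [Group G] {I : Type*} [Fintype I] [DecidableEq I]

theorem groupTrace_canonicalUnitary [DecidableEq G] (g : G) :
    groupTrace G (canonicalUnitary g) = if g = 1 then 1 else 0 := by
  rw [groupTrace_eq, traceVector_canonicalUnitary]
  split_ifs with hg
  · rw [hg, basisVector_apply_self]
  · exact basisVector_apply_ne (Ne.symm hg)

/-- The functional calculus of the commuting involutions `h v` of `G` in the group von Neumann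
algebra. -/
noncomputable def groupCalculus (h : (I → ℤˣ) →* G) : ((I → ℤˣ) → ℂ) →⋆ₐ[ℂ] GroupVN G :=
  signCalculus ((canonicalUnitary.codRestrict _ canonicalUnitary_mem_unitary).comp h)

theorem groupCalculus_signSum (h : (I → ℤˣ) →* G) (J : Finset I) :
    groupCalculus h (fun ε => (signSum J ε : ℂ)) =
      ∑ i ∈ J, canonicalUnitary (h (Pi.mulSingle i (-1))) :=
  signCalculus_signSum _ J

theorem groupTrace_groupCalculus {h : (I → ℤˣ) →* G} (hinj : Function.Injective h)
    (f : (I → ℤˣ) → ℂ) : groupTrace G (groupCalculus h f) = 𝔼 ε, f ε := by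
  classical
  have hproj : ∀ ε, groupTrace G (signProjection
      ((canonicalUnitary.codRestrict _ canonicalUnitary_mem_unitary).comp h) ε) =
      (Fintype.card (I → ℤˣ) : ℂ)⁻¹ := fun ε => by
    simp [signProjection, groupTrace_canonicalUnitary, map_eq_one_iff h hinj]
  rw [groupCalculus, signCalculus_apply, map_sum, Fintype.expect_eq_sum_div_card, Finset.sum_div]
  simp only [map_smul, hproj, smul_eq_mul, div_eq_mul_inv]

theorem norm_traceVector_groupCalculus_sq {h : (I → ℤˣ) →* G} (hinj : Function.Injective h)
    (f : (I → ℤˣ) → ℂ) : ‖traceVector (groupCalculus h f)‖ ^ 2 = 𝔼 ε, ‖f ε‖ ^ 2 := by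
  rw [← Complex.ofReal_inj, ← groupTrace_star_mul_self, ← map_star, ← map_mul,
    groupTrace_groupCalculus hinj, Complex.ofReal_expect]
  refine Finset.expect_congr rfl fun ε _ => ?_
  rw [Pi.mul_apply, Pi.star_apply, Complex.star_def, Complex.conj_mul', Complex.ofReal_pow]

theorem canonicalUnitary_mul_groupCalculus {h : (I → ℤˣ) →* G} {g : G} {J : Finset I} {π : I → I}
    (hπ : Set.InjOn π J) (hg : ∀ i ∈ J, g * h (Pi.mulSingle i (-1)) * g⁻¹ =
      h (Pi.mulSingle (π i) (-1))) (F : ℝ → ℂ) :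
    canonicalUnitary g * groupCalculus h (fun ε => F (signSum J ε)) =
      groupCalculus h (fun ε => F (signSum (J.image π) ε)) * canonicalUnitary g := by
  let conj : GroupVN G ≃⋆ₐ[ℂ] GroupVN G :=
    Unitary.conjStarAlgAut ℂ _ ⟨canonicalUnitary g, canonicalUnitary_mem_unitary g⟩
  have hconj : ∀ a, conj a * canonicalUnitary g = canonicalUnitary g * a := fun a => by
    rw [Unitary.conjStarAlgAut_apply, mul_assoc,
      Unitary.star_mul_self_of_mem (canonicalUnitary_mem_unitary g), mul_one]
  have hsum : conj (groupCalculus h fun ε => (signSum J ε : ℂ)) =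
      groupCalculus h fun ε => (signSum (J.image π) ε : ℂ) := by
    rw [groupCalculus_signSum, groupCalculus_signSum, map_sum, Finset.sum_image hπ]
    refine Finset.sum_congr rfl fun i hi => ?_
    rw [← hg i hi, map_mul, map_mul, ← hconj, mul_assoc, ← map_mul, mul_inv_cancel, map_one,
      mul_one]
  have hcomp := map_comp_eq_map_comp
    (Φ := (conj : GroupVN G →⋆ₐ[ℂ] GroupVN G).toAlgHom.comp (groupCalculus h).toAlgHom)
    (Ψ := (groupCalculus h).toAlgHom) hsum (F ∘ Complex.re)
  rw [← hconj]
  exact congrArg (· * canonicalUnitary g) hcomp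

theorem norm_traceVector_groupCalculus_sub_le {h : (I → ℤˣ) →* G} (hinj : Function.Injective h)
    {F : ℝ → ℂ} {K : ℝ} (hK : 0 ≤ K) (hF : ∀ x y, ‖F x - F y‖ ≤ K * |x - y|) (J : Finset I) :
    ‖traceVector (groupCalculus h (fun ε => F (signSum Finset.univ ε)) -
      groupCalculus h (fun ε => F (signSum J ε)))‖ ≤ K * √(Jᶜ).card := by
  rw [← map_sub]
  refine le_of_sq_le_sq ?_ (by positivity)
  rw [norm_traceVector_groupCalculus_sq hinj, mul_pow, Real.sq_sqrt (Nat.cast_nonneg _)]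
  exact expect_norm_sq_sub_le hF J

theorem norm_traceVector_commutator_groupCalculus_le {h : (I → ℤˣ) →* G}
    (hinj : Function.Injective h) {F : ℝ → ℂ} {K : ℝ} (hK : 0 ≤ K)
    (hF : ∀ x y, ‖F x - F y‖ ≤ K * |x - y|) {g : G} {J : Finset I} {π : I → I}
    (hπ : Set.InjOn π J) (hg : ∀ i ∈ J, g * h (Pi.mulSingle i (-1)) * g⁻¹ =
      h (Pi.mulSingle (π i) (-1))) :
    ‖traceVector (canonicalUnitary g * groupCalculus h (fun ε => F (signSum Finset.univ ε)) -
      groupCalculus h (fun ε => F (signSum Finset.univ ε)) * canonicalUnitary g)‖ ≤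
      2 * (K * √(Jᶜ).card) := by
  have hJ := norm_traceVector_groupCalculus_sub_le hinj hK hF J
  have hπJ := norm_traceVector_groupCalculus_sub_le hinj hK hF (J.image π)
  rw [Finset.card_compl, Finset.card_image_of_injOn hπ, ← Finset.card_compl] at hπJ
  rw [← norm_traceVector_unitary_mul (canonicalUnitary_mem_unitary g)] at hJ
  rw [← norm_traceVector_mul_unitary (canonicalUnitary_mem_unitary g)] at hπJ
  have hsplit : ∀ u v w : GroupVN G, canonicalUnitary g * v = w * canonicalUnitary g →
      canonicalUnitary g * u - u * canonicalUnitary g =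
        canonicalUnitary g * (u - v) - (u - w) * canonicalUnitary g := fun u v w hvw => by
    rw [mul_sub, sub_mul, hvw, sub_sub_sub_cancel_right]
  rw [hsplit _ _ _ (canonicalUnitary_mul_groupCalculus hπ hg F), map_sub, two_mul]
  exact (norm_sub_le _ _).trans (add_le_add hJ hπJ)

end GroupCalculus

section Criterion

/-- `G` contains arbitrarily large finite families of independent commuting involutions, each of
which is approximately permuted under conjugation by any prescribed finite set of elements. The
involutions are the images of the coordinate vectors under an embedding of `Fin n → ℤˣ`. -/
def HasPermutedInvolutions (G : Type*) [Group G] : Prop :=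
  ∀ (S : Finset G) (δ : ℝ), 0 < δ → ∀ N : ℕ, ∃ n ≥ N, ∃ h : (Fin n → ℤˣ) →* G,
    Function.Injective h ∧ ∀ g ∈ S, ∃ (J : Finset (Fin n)) (π : Fin n → Fin n),
      (1 - δ) * n ≤ J.card ∧ Set.InjOn π J ∧
        ∀ i ∈ J, g * h (Pi.mulSingle i (-1)) * g⁻¹ = h (Pi.mulSingle (π i) (-1))

variable {G : Type*} [Group G]

theorem HasPermutedInvolutions.exists_unitary (hG : HasPermutedInvolutions G) (S : Finset G)
    {ε : ℝ} (hε : 0 < ε) : ∃ u ∈ unitary (GroupVN G), groupTrace G u = 0 ∧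
      ∀ g ∈ S, ‖traceVector (canonicalUnitary g * u - u * canonicalUnitary g)‖ < ε := by
  obtain ⟨n, hn, h, hinj, hS⟩ := hG S ((ε / 10) ^ 2) (by positivity) 16
  have hcard : 16 ≤ Fintype.card (Fin n) := by simpa using hn
  obtain ⟨s, hs, hmean⟩ := exists_expect_phase_signSum_eq_zero hcard
  rw [Fintype.card_fin] at hmean
  have hn0 : (0 : ℝ) < n := by exact_mod_cast (show 0 < n by omega)
  have hlip : ∀ x y, ‖phase s (Real.pi / (2 * √n)) x - phase s (Real.pi / (2 * √n)) y‖ ≤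
      Real.pi ^ 2 / (2 * √n) * |x - y| := fun x y => by
    refine (norm_phase_sub_le _ _ _ _).trans ?_
    rw [abs_of_nonneg hs.1, abs_of_nonneg (by positivity), sq, mul_div_assoc]
    gcongr
    exact hs.2
  refine ⟨groupCalculus h _, signCalculus_mem_unitary _ fun v => norm_phase _ _ _,
    (groupTrace_groupCalculus hinj _).trans hmean, fun g hg => ?_⟩
  obtain ⟨J, π, hJ, hπ, hconj⟩ := hS g hg
  refine (norm_traceVector_commutator_groupCalculus_le hinj (by positivity) hlip hπ
    hconj).trans_lt ?_
  have hcompl : √(Jᶜ).card ≤ ε / 10 * √n := by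
    refine Real.sqrt_le_iff.2 ⟨by positivity, ?_⟩
    rw [mul_pow, Real.sq_sqrt hn0.le, Finset.card_compl, Fintype.card_fin,
      Nat.cast_sub (by simpa using J.card_le_univ)]
    linarith
  have hpi : Real.pi ^ 2 < 10 := by nlinarith [Real.pi_lt_d2, Real.pi_pos]
  calc 2 * (Real.pi ^ 2 / (2 * √n) * √(Jᶜ).card)
      ≤ 2 * (Real.pi ^ 2 / (2 * √n) * (ε / 10 * √n)) := by gcongr
    _ = Real.pi ^ 2 / 10 * ε := by field_simp
    _ < ε := by nlinarith

theorem HasPermutedInvolutions.exists_ne_one (hG : HasPermutedInvolutions G) :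
    ∃ g : G, g ≠ 1 := by
  obtain ⟨n, hn, h, hinj, -⟩ := hG ∅ 1 one_pos 1
  refine ⟨h (Pi.mulSingle ⟨0, hn⟩ (-1)), (map_ne_one_iff h hinj).2 fun hone => ?_⟩
  exact absurd ((Pi.mulSingle_eq_one_iff).1 hone) (by decide)

theorem HasPermutedInvolutions.hasPropertyGamma (hG : HasPermutedInvolutions G) (hICC : IsICC G) :
    HasPropertyGamma G := by
  obtain ⟨g, hg⟩ := hG.exists_ne_one
  have : Infinite G := Set.infinite_univ_iff.1 ((hICC g hg).mono (Set.subset_univ _))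
  exact hICC.hasPropertyGamma fun S _ hε => hG.exists_unitary S hε

end Criterion

/-! ### Permutations of towers -/

section Cocycle

variable {Γ X ι : Type*} [Group Γ] [TopologicalSpace X] [MulAction Γ X]

theorem IsPiecewiseAction.exists_locallyConstant {T : X ≃ₜ X} (h : IsPiecewiseAction Γ T) :
    ∃ c : LocallyConstant X Γ, ∀ x, T x = c x • x := by
  obtain ⟨n, A, s, hclopen, hdisj, hcover, hT⟩ := h
  choose i hi using fun x => Set.mem_iUnion.1 (hcover ▸ Set.mem_univ x)
  refine ⟨⟨s ∘ i, ((IsLocallyConstant.iff_eventually_eq i).2 fun x => ?_).comp s⟩,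
    fun x => hT _ _ (hi x)⟩
  filter_upwards [(hclopen (i x)).isOpen.mem_nhds (hi x)] with y hy
  by_contra hne
  exact Set.disjoint_left.1 (hdisj hne) (hi y) hy

theorem continuous_of_eqOn_smul [ContinuousConstSMul Γ X] {f : X → X} {A : ι → Set X} {s : ι → Γ}
    (hopen : ∀ i, IsOpen (A i)) (hcover : ⋃ i, A i = Set.univ)
    (hf : ∀ i, ∀ x ∈ A i, f x = s i • x) : Continuous f := by
  refine continuous_of_cover_nhds (s := A) (fun x => ?_) fun i =>
    (continuous_const_smul (s i)).continuousOn.congr (hf i)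
  obtain ⟨i, hi⟩ := Set.mem_iUnion.1 (hcover ▸ Set.mem_univ x)
  exact ⟨i, (hopen i).mem_nhds hi⟩

end Cocycle

section Translates

open scoped Pointwise

variable {Γ X ι κ : Type*} [Group Γ] [TopologicalSpace X] [MulAction Γ X]

/-- The base `A` and the shape `s` of a tower whose levels are the translates `s i • A`: the set `A`
is clopen and its translates are pairwise disjoint, which is encoded as injectivity of
`(i, a) ↦ s i • a` on `ι × A`. -/
structure HasDisjointTranslates (s : ι → Γ) (A : Set X) : Prop where
  isClopen : IsClopen A
  injective : Function.Injective fun p : ι × A => s p.1 • (p.2 : X)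

namespace HasDisjointTranslates

variable {s s' : ι → Γ} {A : Set X}

theorem disjoint_smul (hA : HasDisjointTranslates s A) {i j : ι} (hij : i ≠ j) :
    Disjoint (s i • A) (s j • A) := by
  rw [Set.disjoint_left]
  rintro _ ⟨a, ha, rfl⟩ ⟨b, hb, hab⟩
  exact hij (congrArg Prod.fst (hA.injective (a₁ := (j, ⟨b, hb⟩)) (a₂ := (i, ⟨a, ha⟩)) hab)).symm

theorem comp (hA : HasDisjointTranslates s A) (e : κ ↪ ι) : HasDisjointTranslates (s ∘ e) A :=
  ⟨hA.isClopen, hA.injective.comp (e.injective.prodMap Function.injective_id)⟩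

/-- The permutation of `X` moving the level `s i • A` onto `s (σ i) • A` and fixing all points
outside the tower, as a homomorphism in `σ`. -/
noncomputable def levelPerm (hA : HasDisjointTranslates s A) :
    Equiv.Perm ι →* Equiv.Perm X :=
  (Equiv.Perm.viaEmbeddingHom ⟨_, hA.injective⟩).comp
    { toFun σ := σ.prodCongr (Equiv.refl A), map_one' := rfl, map_mul' _ _ := rfl }

theorem levelPerm_smul (hA : HasDisjointTranslates s A) (σ : Equiv.Perm ι) (i : ι) {a : X}
    (ha : a ∈ A) : hA.levelPerm σ (s i • a) = s (σ i) • a :=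
  Equiv.Perm.viaEmbedding_apply _ ⟨_, hA.injective⟩ (i, ⟨a, ha⟩)

theorem levelPerm_of_forall_notMem (hA : HasDisjointTranslates s A) (σ : Equiv.Perm ι) {x : X}
    (hx : ∀ i, x ∉ s i • A) : hA.levelPerm σ x = x := by
  refine Equiv.Perm.viaEmbedding_apply_of_notMem _ ⟨_, hA.injective⟩ x ?_
  rintro ⟨⟨i, a⟩, rfl⟩
  exact hx i (Set.smul_mem_smul_set a.2)

variable [ContinuousConstSMul Γ X]

theorem isClopen_smul (hA : HasDisjointTranslates s A) (i : ι) : IsClopen (s i • A) :=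
  ⟨hA.isClopen.isClosed.smul _, hA.isClopen.isOpen.smul _⟩

variable [Finite ι]

theorem exists_clopen_partition (hA : HasDisjointTranslates s A) :
    ∃ B : Option ι → Set X, (∀ o, IsClopen (B o)) ∧ Pairwise (Function.onFun Disjoint B) ∧
      ⋃ o, B o = Set.univ ∧ ∀ (σ : Equiv.Perm ι) (o), ∀ x ∈ B o,
        hA.levelPerm σ x = (o.elim 1 fun i => s (σ i) * (s i)⁻¹ : Γ) • x := by
  refine ⟨fun o => o.elim (⋃ i, s i • A)ᶜ fun i => s i • A, ?_, ?_, ?_, ?_⟩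
  · rintro (_ | i)
    · exact (isClopen_iUnion_of_finite hA.isClopen_smul).compl
    · exact hA.isClopen_smul i
  · rintro (_ | i) (_ | j) hij
    · exact (hij rfl).elim
    · exact Set.disjoint_compl_left_iff_subset.2 (Set.subset_iUnion (fun i => s i • A) j)
    · exact Set.disjoint_compl_right_iff_subset.2 (Set.subset_iUnion (fun i => s i • A) i)
    · exact hA.disjoint_smul fun h => hij (congrArg some h)
  · rw [Set.iUnion_option]
    exact Set.compl_union_self _
  · rintro σ (_ | i) x hx
    · rw [hA.levelPerm_of_forall_notMem σ fun i hi => hx (Set.mem_iUnion_of_mem i hi)]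
      exact (one_smul Γ x).symm
    · obtain ⟨a, ha, rfl⟩ := hx
      rw [hA.levelPerm_smul σ i ha, Option.elim_some, smul_smul, inv_mul_cancel_right]

theorem continuous_levelPerm (hA : HasDisjointTranslates s A) (σ : Equiv.Perm ι) :
    Continuous (hA.levelPerm σ) := by
  obtain ⟨B, hclopen, -, hcover, hB⟩ := hA.exists_clopen_partition
  exact continuous_of_eqOn_smul (fun o => (hclopen o).isOpen) hcover (hB σ)

/-- The action of the permutations of the index set of a tower on `X` by permuting its levels. -/
noncomputable def permHom (hA : HasDisjointTranslates s A) :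
    Equiv.Perm ι →* topologicalFullGroup Γ X where
  toFun σ :=
    ⟨{ toEquiv := hA.levelPerm σ
       continuous_toFun := hA.continuous_levelPerm σ
       continuous_invFun := by
         change Continuous ⇑(hA.levelPerm σ)⁻¹
         rw [← map_inv]
         exact hA.continuous_levelPerm σ⁻¹ }, by
      obtain ⟨B, hclopen, hdisj, hcover, hB⟩ := hA.exists_clopen_partition
      exact IsPiecewiseAction.of_finite B _ hclopen hdisj hcover (hB σ)⟩
  map_one' := Subtype.ext (Homeomorph.ext fun x => by simp)
  map_mul' σ τ := Subtype.ext (Homeomorph.ext fun x => by simp)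

theorem permHom_smul (hA : HasDisjointTranslates s A) (σ : Equiv.Perm ι) (i : ι) {a : X}
    (ha : a ∈ A) : (hA.permHom σ : X ≃ₜ X) (s i • a) = s (σ i) • a :=
  hA.levelPerm_smul σ i ha

theorem permHom_of_forall_notMem (hA : HasDisjointTranslates s A) (σ : Equiv.Perm ι) {x : X}
    (hx : ∀ i, x ∉ s i • A) : (hA.permHom σ : X ≃ₜ X) x = x :=
  hA.levelPerm_of_forall_notMem σ hx

theorem eq_permHom (hA : HasDisjointTranslates s A) {σ : Equiv.Perm ι}
    {T : topologicalFullGroup Γ X} (hT : ∀ i, ∀ a ∈ A, (T : X ≃ₜ X) (s i • a) = s (σ i) • a)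
    (hT' : ∀ x, (∀ i, x ∉ s i • A) → (T : X ≃ₜ X) x = x) : T = hA.permHom σ := by
  refine Subtype.ext (Homeomorph.ext fun x => ?_)
  by_cases hx : ∀ i, x ∉ s i • A
  · rw [hT' x hx, hA.permHom_of_forall_notMem σ hx]
  · push Not at hx
    obtain ⟨i, a, ha, rfl⟩ := hx
    exact (hT i a ha).trans (hA.permHom_smul σ i ha).symm

theorem permHom_injective (hA : HasDisjointTranslates s A) (hne : A.Nonempty) :
    Function.Injective hA.permHom := by
  obtain ⟨a, ha⟩ := hne
  intro σ τ hστ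
  ext i
  have hsmul : s (σ i) • a = s (τ i) • a := by
    rw [← hA.permHom_smul σ i ha, hστ, hA.permHom_smul τ i ha]
  exact congrArg Prod.fst (hA.injective (a₁ := (σ i, ⟨a, ha⟩)) (a₂ := (τ i, ⟨a, ha⟩)) hsmul)

theorem conj_permHom (hA : HasDisjointTranslates s A) (hA' : HasDisjointTranslates s' A)
    {T : topologicalFullGroup Γ X} (hT : ∀ i, ∀ a ∈ A, (T : X ≃ₜ X) (s i • a) = s' i • a)
    (σ : Equiv.Perm ι) : T * hA.permHom σ * T⁻¹ = hA'.permHom σ := by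
  refine hA'.eq_permHom (fun i a ha => ?_) fun x hx => ?_
  · change (T : X ≃ₜ X) ((hA.permHom σ : X ≃ₜ X) ((T : X ≃ₜ X).symm (s' i • a))) = _
    rw [← hT i a ha, Homeomorph.symm_apply_apply, hA.permHom_smul σ i ha, hT _ a ha]
  · change (T : X ≃ₜ X) ((hA.permHom σ : X ≃ₜ X) ((T : X ≃ₜ X).symm x)) = _
    rw [hA.permHom_of_forall_notMem σ, Homeomorph.apply_symm_apply]
    rintro i ⟨a, ha, hax⟩
    refine hx i ⟨a, ha, ?_⟩
    exact (hT i a ha).symm.trans ((Homeomorph.symm_apply_eq _).1 hax.symm).symm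

theorem permHom_eq_permHom_comp [Finite κ] (hA : HasDisjointTranslates s A) (e : κ ↪ ι)
    {σ : Equiv.Perm ι} {τ : Equiv.Perm κ} (hσ : ∀ k, σ (e k) = e (τ k))
    (hσ' : ∀ i ∉ Set.range e, σ i = i) : hA.permHom σ = (hA.comp e).permHom τ := by
  refine (hA.comp e).eq_permHom (fun k a ha => ?_) fun x hx => ?_
  · rw [Function.comp_apply, hA.permHom_smul σ _ ha, hσ, Function.comp_apply]
  · by_cases hxA : ∀ i, x ∉ s i • A
    · exact hA.permHom_of_forall_notMem σ hxA
    · push Not at hxA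
      obtain ⟨i, a, ha, rfl⟩ := hxA
      have hi : i ∉ Set.range e := by
        rintro ⟨k, rfl⟩
        exact hx k (Set.smul_mem_smul_set ha)
      exact (hA.permHom_smul σ i ha).trans (congrArg (s · • a) (hσ' i hi))

theorem isSymmetricEmbedding_permHom {d : ℕ} {s : Fin d → Γ} (hA : HasDisjointTranslates s A) :
    IsSymmetricEmbedding Γ X hA.permHom := by
  refine ⟨fun i => s i • A, hA.isClopen_smul, fun i j hij => hA.disjoint_smul hij,
    fun σ => ⟨fun x hx => ?_, fun i => ?_⟩⟩
  · exact hA.permHom_of_forall_notMem σ fun i hi => hx (Set.mem_iUnion_of_mem i hi)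
  · refine (Set.image_image _ _ A).trans (Set.image_congr fun a ha => ?_)
    exact hA.permHom_smul σ i ha

end HasDisjointTranslates

theorem exists_isThreeCycle_restriction [Fintype ι] [DecidableEq ι] {σ : Equiv.Perm ι}
    (hσ : σ.IsThreeCycle) : ∃ (e : Fin 3 ↪ ι), ∃ τ ∈ alternatingGroup (Fin 3),
      (∀ k, σ (e k) = e (τ k)) ∧ ∀ i ∉ Set.range e, σ i = i := by
  let f : {i // σ i ≠ i} ≃ Fin 3 := Fintype.equivFinOfCardEq <|
    (Fintype.card_of_subtype σ.support fun _ => Equiv.Perm.mem_support).trans hσ.card_support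
  have hsupp : ∀ i, σ (σ i) ≠ σ i ↔ σ i ≠ i := fun i => σ.injective.ne_iff
  refine ⟨f.symm.toEmbedding.trans (.subtype _), f.permCongr (σ.subtypePerm hsupp), ?_, ?_, ?_⟩
  · rw [Equiv.Perm.mem_alternatingGroup, Equiv.Perm.sign_permCongr,
      Equiv.Perm.sign_subtypePerm σ hsupp fun _ => id, hσ.sign]
  · intro k
    simp
  · intro i hi
    by_contra hne
    exact hi ⟨f ⟨i, hne⟩, by simp⟩

theorem HasDisjointTranslates.permHom_mem_dynamicalAlternatingGroup [Fintype ι] [DecidableEq ι]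
    [ContinuousConstSMul Γ X] {s : ι → Γ} {A : Set X} (hA : HasDisjointTranslates s A)
    {σ : Equiv.Perm ι} (hσ : σ ∈ alternatingGroup ι) :
    hA.permHom σ ∈ dynamicalAlternatingGroup Γ X := by
  suffices h : Subgroup.closure {τ : Equiv.Perm ι | τ.IsThreeCycle} ≤
      (dynamicalAlternatingGroup Γ X).comap hA.permHom by
    rw [Equiv.Perm.closure_three_cycles_eq_alternating] at h
    exact h hσ
  refine (Subgroup.closure_le _).2 fun ρ hρ => ?_
  obtain ⟨e, τ, hτ, hρe, hρ'⟩ := exists_isThreeCycle_restriction hρ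
  exact Subgroup.subset_closure ⟨_, (hA.comp e).isSymmetricEmbedding_permHom, τ, hτ,
    (hA.permHom_eq_permHom_comp e hρe hρ').symm⟩

end Translates

section FreePoints

variable {Γ X ι : Type*} [Group Γ] [MulAction Γ X]

theorem smul_injective_of_stabilizer_eq_bot {x : X} (hx : MulAction.stabilizer Γ x = ⊥) :
    Function.Injective fun g : Γ => g • x := by
  intro g h hgh
  have hmem : h⁻¹ * g ∈ MulAction.stabilizer Γ x := by
    rw [MulAction.mem_stabilizer_iff, mul_smul, show g • x = h • x from hgh, inv_smul_smul]
  rw [hx, Subgroup.mem_bot] at hmem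
  exact (inv_mul_eq_one.1 hmem).symm

variable [TopologicalSpace X] [ContinuousConstSMul Γ X] [T2Space X] [CompactSpace X]
  [TotallyDisconnectedSpace X]

theorem exists_hasDisjointTranslates_mem [Finite ι] {x : X} (hx : MulAction.stabilizer Γ x = ⊥)
    {s : ι → Γ} (hs : Function.Injective s) {U : Set X} (hU : U ∈ nhds x) :
    ∃ A, HasDisjointTranslates s A ∧ x ∈ A ∧ A ⊆ U := by
  have hne : ∀ᶠ p : X × X in nhds x ×ˢ nhds x, ∀ i j, i ≠ j → s i • p.1 ≠ s j • p.2 := by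
    simp only [← nhds_prod_eq, Filter.eventually_all]
    intro i j hij
    have hopen : IsOpen {p : X × X | s i • p.1 ≠ s j • p.2} :=
      isOpen_ne_fun (continuous_fst.const_smul _) (continuous_snd.const_smul _)
    exact hopen.mem_nhds fun h => hij (hs (smul_injective_of_stabilizer_eq_bot hx h))
  obtain ⟨V, hV, hVne⟩ := Filter.eventually_prod_self_iff'.1 hne
  obtain ⟨A, hA, hxA, hAUV⟩ := compact_exists_isClopen_in_isOpen isOpen_interior
    (mem_interior_iff_mem_nhds.2 (Filter.inter_mem hU hV))
  have hAU : A ⊆ U := fun a ha => (interior_subset (hAUV ha)).1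
  have hAV : A ⊆ V := fun a ha => (interior_subset (hAUV ha)).2
  refine ⟨A, ⟨hA, ?_⟩, hxA, hAU⟩
  rintro ⟨i, a⟩ ⟨j, b⟩ hab
  obtain rfl : i = j := by
    by_contra hij
    exact hVne a (hAV a.2) b (hAV b.2) i j hij hab
  exact Prod.ext rfl (Subtype.ext (smul_left_cancel _ hab))

theorem exists_mem_dynamicalAlternatingGroup_forall_smul_eq [Fintype ι] [DecidableEq ι] {x : X}
    (hx : MulAction.stabilizer Γ x = ⊥) {s : ι → Γ} (hs : Function.Injective s)
    {σ : Equiv.Perm ι} (hσ : σ ∈ alternatingGroup ι) :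
    ∃ T ∈ dynamicalAlternatingGroup Γ X, ∀ i, (T : X ≃ₜ X) (s i • x) = s (σ i) • x := by
  obtain ⟨A, hA, hxA, -⟩ := exists_hasDisjointTranslates_mem hx hs Filter.univ_mem
  exact ⟨_, hA.permHom_mem_dynamicalAlternatingGroup hσ, fun i => hA.permHom_smul σ i hxA⟩

theorem exists_mem_dynamicalAlternatingGroup_smul_eq [Infinite Γ] {x : X}
    (hx : MulAction.stabilizer Γ x = ⊥) {s p : Γ} (hs : s ≠ 1) (hp : p ≠ 1) (hps : p ≠ s) :
    ∃ T ∈ dynamicalAlternatingGroup Γ X, (T : X ≃ₜ X) x = x ∧ (T : X ≃ₜ X) (s • x) = p • x := by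
  classical
  obtain ⟨q, hq⟩ := Infinite.exists_notMem_finset ({1, s, p} : Finset Γ)
  simp only [Finset.mem_insert, Finset.mem_singleton, not_or] at hq
  have hinj : Function.Injective ![1, s, p, q] := by
    intro i j
    fin_cases i <;> fin_cases j <;> simp <;> grind
  obtain ⟨σ, hσ, hσ₀, hσ₁⟩ : ∃ σ ∈ alternatingGroup (Fin 4), σ 0 = 0 ∧ σ 1 = 2 :=
    ⟨Equiv.swap 1 2 * Equiv.swap 2 3, Equiv.Perm.mem_alternatingGroup.2 (by decide), by decide,
      by decide⟩
  obtain ⟨T, hT, hTsmul⟩ := exists_mem_dynamicalAlternatingGroup_forall_smul_eq hx hinj hσ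
  exact ⟨T, hT, by simpa [hσ₀] using hTsmul 0, by simpa [hσ₁] using hTsmul 1⟩

theorem isICC_of_dynamicalAlternatingGroup_le [Infinite Γ] (hfree : IsTopologicallyFree Γ X)
    {G : Subgroup (topologicalFullGroup Γ X)} (hG : dynamicalAlternatingGroup Γ X ≤ G) :
    IsICC G := by
  intro g hg
  let g' : X ≃ₜ X := (g : topologicalFullGroup Γ X)
  obtain ⟨y, hy⟩ : ∃ y, g' y ≠ y := by
    by_contra! h
    exact hg (Subtype.ext (Subtype.ext (Homeomorph.ext h)))
  obtain ⟨x, hgx, hx⟩ := hfree.inter_open_nonempty {y | g' y ≠ y}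
    (isOpen_ne_fun g'.continuous continuous_id) ⟨y, hy⟩
  obtain ⟨c, hc⟩ := IsPiecewiseAction.exists_locallyConstant (g : topologicalFullGroup Γ X).2
  have hcx : c x ≠ 1 := fun h => hgx (by rw [hc, h, one_smul])
  -- a conjugate of `g` sends `x` to `p • x`, for every `p` outside `{1, c x}`
  have hconj : (fun p : Γ => p • x) '' ({1, c x} : Set Γ)ᶜ ⊆
      (fun k : G => ((k : topologicalFullGroup Γ X) : X ≃ₜ X) x) '' conjugatesOf g := by
    rintro _ ⟨p, hp, rfl⟩
    simp only [Set.mem_compl_iff, Set.mem_insert_iff, Set.mem_singleton_iff, not_or] at hp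
    obtain ⟨T, hT, hTx, hTcx⟩ := exists_mem_dynamicalAlternatingGroup_smul_eq hx hcx hp.1 hp.2
    refine ⟨⟨T, hG hT⟩ * g * ⟨T, hG hT⟩⁻¹, isConj_iff.2 ⟨⟨T, hG hT⟩, rfl⟩, ?_⟩
    change (T : X ≃ₜ X) (g' ((T : X ≃ₜ X).symm x)) = p • x
    rw [(Homeomorph.symm_apply_eq _).2 hTx.symm, hc, hTcx]
  have hinf : ((fun p : Γ => p • x) '' ({1, c x} : Set Γ)ᶜ).Infinite :=
    Set.Infinite.image (smul_injective_of_stabilizer_eq_bot hx).injOn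
      (Set.toFinite _).infinite_compl
  exact (hinf.mono hconj).of_image _

end FreePoints

section DoubleTranspositions

/-- The sign group acting on four letters, with `-1` acting by a product of two disjoint
transpositions, so that the action is faithful and even. -/
def doubleTransposition : ℤˣ →* Equiv.Perm (Fin 4) where
  toFun a := if a = -1 then Equiv.swap 0 1 * Equiv.swap 2 3 else 1
  map_one' := by decide
  map_mul' := by decide

theorem doubleTransposition_injective : Function.Injective doubleTransposition := by
  unfold Function.Injective
  decide

theorem doubleTransposition_mem_alternatingGroup (a : ℤˣ) :
    doubleTransposition a ∈ alternatingGroup (Fin 4) := by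
  rw [Equiv.Perm.mem_alternatingGroup]
  revert a
  decide

variable {I : Type*}

/-- Independent double transpositions of the fibers of `I × Fin 4 → I`, one sign for each fiber. -/
def fiberwiseDoubleTransposition (I : Type*) : (I → ℤˣ) →* Equiv.Perm (I × Fin 4) where
  toFun v := Equiv.prodCongrRight fun i => doubleTransposition (v i)
  map_one' := by ext ⟨i, j⟩ <;> simp
  map_mul' v w := by ext ⟨i, j⟩ <;> simp

theorem fiberwiseDoubleTransposition_injective :
    Function.Injective (fiberwiseDoubleTransposition I) := by
  intro v w h
  funext i
  refine doubleTransposition_injective (Equiv.ext fun j => ?_)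
  exact congrArg Prod.snd (DFunLike.congr_fun h (i, j))

theorem fiberwiseDoubleTransposition_mem_alternatingGroup [Fintype I] [DecidableEq I]
    (v : I → ℤˣ) : fiberwiseDoubleTransposition I v ∈ alternatingGroup (I × Fin 4) := by
  rw [Equiv.Perm.mem_alternatingGroup]
  exact (Equiv.Perm.sign_prodCongrRight _).trans
    (Finset.prod_eq_one fun i _ => doubleTransposition_mem_alternatingGroup (v i))

variable {Γ X : Type*} [Group Γ] [TopologicalSpace X] [MulAction Γ X] [ContinuousConstSMul Γ X]
  [Finite I] [DecidableEq I] {s : I × Fin 4 → Γ} {A : Set X}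

theorem HasDisjointTranslates.permHom_fiberwiseDoubleTransposition_mulSingle
    (hA : HasDisjointTranslates s A) (i : I) (a : ℤˣ) :
    hA.permHom (fiberwiseDoubleTransposition I (Pi.mulSingle i a)) =
      (hA.comp (Function.Embedding.sectR i (Fin 4))).permHom (doubleTransposition a) := by
  refine hA.permHom_eq_permHom_comp _ (fun j => ?_) fun ⟨k, j⟩ hk => ?_
  · simp [fiberwiseDoubleTransposition]
  · have hki : k ≠ i := by
      rintro rfl
      exact hk ⟨j, rfl⟩
    simp [fiberwiseDoubleTransposition, hki]

theorem HasDisjointTranslates.conj_permHom_fiberwiseDoubleTransposition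
    (hA : HasDisjointTranslates s A) {T : topologicalFullGroup Γ X} {i k : I}
    (hT : ∀ j, ∀ a ∈ A, (T : X ≃ₜ X) (s (i, j) • a) = s (k, j) • a) (ε : ℤˣ) :
    T * hA.permHom (fiberwiseDoubleTransposition I (Pi.mulSingle i ε)) * T⁻¹ =
      hA.permHom (fiberwiseDoubleTransposition I (Pi.mulSingle k ε)) := by
  simp only [hA.permHom_fiberwiseDoubleTransposition_mulSingle]
  exact (hA.comp _).conj_permHom (hA.comp _) hT _

end DoubleTranspositions

/-! ### Towers over Følner sets -/

section Towers

variable {Γ ι : Type*} [Group Γ]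

theorem exists_seq_injective_mul [Finite ι] {t : ι → Γ} (ht : Function.Injective t) {R : Set Γ}
    (hR : R.Infinite) :
    ∃ r : ℕ → Γ, (∀ j, r j ∈ R) ∧ Function.Injective fun p : ι × ℕ => t p.1 * r p.2 := by
  have : Std.Symm fun a b : Γ => ∀ i k, t i * a ≠ t k * b := ⟨fun _ _ h i k => (h k i).symm⟩
  obtain ⟨r, hrR, hr⟩ := exists_seq_of_forall_finset_exists' (· ∈ R)
    (fun a b => ∀ i k, t i * a ≠ t k * b) fun s _ => by
      have hfin : (Set.range fun p : ι × s × ι => (t p.2.2)⁻¹ * (t p.1 * p.2.1)).Finite :=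
        Set.finite_range _
      obtain ⟨b, hb, hbs⟩ := hR.exists_notMem_finite hfin
      exact ⟨b, hb, fun a ha i k h => hbs ⟨(i, ⟨a, ha⟩, k), inv_mul_eq_of_eq_mul h⟩⟩
  refine ⟨r, hrR, ?_⟩
  rintro ⟨i, j⟩ ⟨k, l⟩ h
  obtain rfl : j = l := by
    by_contra hjl
    exact hr hjl i k h
  exact Prod.ext (ht (mul_right_cancel h)) rfl

theorem IsAmenableGroup.exists_injective_almost_invariant [Infinite Γ] (hΓ : IsAmenableGroup Γ)
    (T : Finset Γ) {δ : ℝ} (hδ : 0 < δ) (N : ℕ) :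
    ∃ n ≥ N, ∃ t : Fin n → Γ, Function.Injective t ∧ ∃ J : Finset (Fin n),
      (1 - δ) * n ≤ J.card ∧ ∀ i ∈ J, ∀ s ∈ T, s * t i ∈ Set.range t := by
  classical
  obtain ⟨E, hE⟩ := Infinite.exists_subset_card_eq Γ N
  obtain ⟨F, hF, hinv⟩ := hΓ (T ∪ E) (min δ (1 / 2)) (by positivity)
  obtain ⟨t, ht, hrange⟩ : ∃ t : Fin F.card → Γ, Function.Injective t ∧ Set.range t = F :=
    ⟨Subtype.val ∘ F.equivFin.symm, Subtype.val_injective.comp F.equivFin.symm.injective, by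
      rw [F.equivFin.symm.surjective.range_comp, Subtype.range_coe_subtype, Finset.setOfPred_mem]⟩
  let J : Finset (Fin F.card) := {i | ∀ s ∈ T ∪ E, s * t i ∈ F}
  have hJ : {a : Γ | a ∈ F ∧ ∀ s ∈ T ∪ E, s * a ∈ F} = t '' J := by
    rw [show (J : Set (Fin F.card)) = t ⁻¹' {a | ∀ s ∈ T ∪ E, s * a ∈ F} from
      Finset.coe_filter_univ _, Set.image_preimage_eq_range_inter, hrange]
    rfl
  rw [IsInvariantUpTo, hJ, Set.ncard_image_of_injective _ ht, Set.ncard_coe_finset] at hinv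
  have hFpos : (0 : ℝ) < F.card := by exact_mod_cast hF.card_pos
  have hmem : ∀ i ∈ J, ∀ s ∈ T ∪ E, s * t i ∈ F := fun i hi => (Finset.mem_filter.1 hi).2
  refine ⟨F.card, ?_, t, ht, J, ?_, fun i hi s hs => ?_⟩
  · have hJpos : (0 : ℝ) < J.card := by nlinarith [min_le_right δ (1 / 2 : ℝ)]
    obtain ⟨i, hi⟩ := Finset.card_pos.1 (Nat.cast_pos.1 hJpos)
    rw [ge_iff_le, ← hE]
    exact Finset.card_le_card_of_injOn (· * t i)
      (fun s hs => hmem i hi s (Finset.mem_union_right _ hs)) (mul_left_injective _).injOn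
  · nlinarith [min_le_left δ (1 / 2 : ℝ)]
  · rw [hrange]
    exact hmem i hi s (Finset.mem_union_left _ hs)

variable {X : Type*} [TopologicalSpace X] [MulAction Γ X] [ContinuousConstSMul Γ X] [T2Space X]
  [CompactSpace X] [TotallyDisconnectedSpace X]

theorem exists_hasDisjointTranslates_locallyConstant_eq [Infinite Γ] [Finite ι] {x : X}
    (hx : MulAction.stabilizer Γ x = ⊥) {t : ι → Γ} (ht : Function.Injective t) {E : Type*}
    (c : LocallyConstant X E) (d : ℕ) :
    ∃ (r : Fin d → Γ) (A : Set X) (k : ι → E),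
      HasDisjointTranslates (fun p : ι × Fin d => t p.1 * r p.2) A ∧ x ∈ A ∧
        ∀ i j, ∀ a ∈ A, c ((t i * r j) • a) = k i := by
  have : Finite (Set.range c) := c.range_finite
  -- only finitely many patterns `i ↦ c (t i • r • x)` occur, so infinitely many `r` share one
  obtain ⟨k, hk⟩ := Finite.exists_infinite_fiber fun (r : Γ) (i : ι) =>
    (⟨c ((t i * r) • x), Set.mem_range_self _⟩ : Set.range c)
  obtain ⟨r, hrk, hr⟩ := exists_seq_injective_mul ht (Set.infinite_coe_iff.1 hk)
  have hU : ∀ᶠ a in nhds x, ∀ i, ∀ j : Fin d, c ((t i * r j) • a) = k i := by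
    simp only [Filter.eventually_all]
    intro i j
    have hlim := (continuous_const_smul (t i * r j)).tendsto x
    filter_upwards [hlim.eventually (c.isLocallyConstant.eventually_eq _)] with a ha
    exact ha.trans (congrArg Subtype.val (congrFun (hrk j) i))
  obtain ⟨A, hA, hxA, hAU⟩ := exists_hasDisjointTranslates_mem hx
    (hr.comp (Function.injective_id.prodMap (Fin.val_injective (n := d)))) hU
  exact ⟨fun j => r j, A, fun i => k i, hA, hxA, fun i j a ha => hAU ha i j⟩

theorem exists_hasDisjointTranslates_almost_permuted [Infinite Γ] [Nonempty X]
    (hΓ : IsAmenableGroup Γ) (hfree : IsTopologicallyFree Γ X)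
    (S : Finset (topologicalFullGroup Γ X)) {δ : ℝ} (hδ : 0 < δ) (N d : ℕ) [NeZero d] :
    ∃ n ≥ N, ∃ (s : Fin n × Fin d → Γ) (A : Set X), HasDisjointTranslates s A ∧ A.Nonempty ∧
      ∀ g ∈ S, ∃ (J : Finset (Fin n)) (π : Fin n → Fin n), (1 - δ) * n ≤ J.card ∧
        Set.InjOn π J ∧ ∀ i ∈ J, ∀ j, ∀ a ∈ A, (g : X ≃ₜ X) (s (i, j) • a) = s (π i, j) • a := by
  choose c hc using fun g : topologicalFullGroup Γ X =>
    IsPiecewiseAction.exists_locallyConstant g.2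
  let C : LocallyConstant X (S → Γ) := .unflip fun g => c g
  have hfin : (⋃ g : S, Set.range (c g)).Finite := Set.finite_iUnion fun g => (c g).range_finite
  obtain ⟨n, hn, t, ht, J, hJ, hinv⟩ := hΓ.exists_injective_almost_invariant hfin.toFinset hδ N
  obtain ⟨x, hx⟩ := hfree.nonempty
  obtain ⟨r, A, k, hA, hxA, hk⟩ := exists_hasDisjointTranslates_locallyConstant_eq hx ht C d
  refine ⟨n, hn, _, A, hA, ⟨x, hxA⟩, fun g hg => ?_⟩
  have hcg : ∀ i j, ∀ a ∈ A, c g ((t i * r j) • a) = k i ⟨g, hg⟩ := fun i j a ha =>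
    congrFun (hk i j a ha) ⟨g, hg⟩
  have hkT : ∀ i, k i ⟨g, hg⟩ ∈ hfin.toFinset := fun i =>
    hfin.mem_toFinset.2 (Set.mem_iUnion.2 ⟨⟨g, hg⟩, _, hcg i 0 x hxA⟩)
  choose! π hπ using fun i hi => hinv i hi _ (hkT i)
  have hmove : ∀ i ∈ J, ∀ j, ∀ a ∈ A,
      (g : X ≃ₜ X) ((t i * r j) • a) = (t (π i) * r j) • a := fun i hi j a ha => by
    rw [hc, hcg i j a ha, smul_smul, ← mul_assoc, hπ i hi]
  refine ⟨J, π, hJ, fun i hi i' hi' hii' => ?_, hmove⟩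
  have hgx : (g : X ≃ₜ X) ((t i * r 0) • x) = (g : X ≃ₜ X) ((t i' * r 0) • x) := by
    rw [hmove i hi 0 x hxA, hmove i' hi' 0 x hxA, hii']
  exact ht (mul_right_cancel (smul_injective_of_stabilizer_eq_bot hx
    ((g : X ≃ₜ X).injective hgx)))

theorem hasPermutedInvolutions_of_dynamicalAlternatingGroup_le [Infinite Γ] [Nonempty X]
    (hΓ : IsAmenableGroup Γ) (hfree : IsTopologicallyFree Γ X)
    {G : Subgroup (topologicalFullGroup Γ X)} (hG : dynamicalAlternatingGroup Γ X ≤ G) :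
    HasPermutedInvolutions G := by
  intro S δ hδ N
  obtain ⟨n, hn, s, A, hA, hne, hS⟩ := exists_hasDisjointTranslates_almost_permuted hΓ hfree
    (S.map (.subtype (· ∈ G))) hδ N 4
  let h := hA.permHom.comp (fiberwiseDoubleTransposition (Fin n))
  have hmem : ∀ v, h v ∈ G := fun v =>
    hG (hA.permHom_mem_dynamicalAlternatingGroup
      (fiberwiseDoubleTransposition_mem_alternatingGroup v))
  refine ⟨n, hn, h.codRestrict G hmem, ?_, fun g hg => ?_⟩
  · exact (MonoidHom.injective_codRestrict h G hmem).2
      ((hA.permHom_injective hne).comp fiberwiseDoubleTransposition_injective)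
  obtain ⟨J, π, hJ, hπ, hmove⟩ := hS g (Finset.mem_map_of_mem _ hg)
  exact ⟨J, π, hJ, hπ, fun i hi => Subtype.ext
    (hA.conj_permHom_fiberwiseDoubleTransposition (hmove i hi) (-1))⟩

end Towers

theorem mainTheorem1_general {Γ X : Type*} [Group Γ] [Infinite Γ] (hΓ : IsAmenableGroup Γ)
    [TopologicalSpace X] [CompactSpace X] [T2Space X] [TotallyDisconnectedSpace X] [Nonempty X]
    [MulAction Γ X] [ContinuousConstSMul Γ X] (hfree : IsTopologicallyFree Γ X)
    (G : Subgroup (topologicalFullGroup Γ X)) (hG : dynamicalAlternatingGroup Γ X ≤ G) :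
    HasPropertyGamma G :=
  (hasPermutedInvolutions_of_dynamicalAlternatingGroup_le hΓ hfree hG).hasPropertyGamma
    (isICC_of_dynamicalAlternatingGroup_le hfree hG)

theorem mainTheorem1 {Γ X : Type*} [Group Γ] [Countable Γ] [Infinite Γ]
    (hΓ : IsAmenableGroup Γ)
    [TopologicalSpace X] (hX : Nonempty (X ≃ₜ cantorSet))
    [MulAction Γ X] [ContinuousConstSMul Γ X]
    (hfree : IsTopologicallyFree Γ X)
    (G : Subgroup (topologicalFullGroup Γ X))
    (hG : dynamicalAlternatingGroup Γ X ≤ G) :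
    HasPropertyGamma G := by
  obtain ⟨e⟩ := hX
  let e' : (ℕ → Bool) ≃ₜ X := (e.trans cantorSetHomeomorphNatToBool).symm
  have := e'.compactSpace
  have := e'.t2Space
  have := e'.totallyDisconnectedSpace
  have : Nonempty X := ⟨e' fun _ => true⟩
  exact mainTheorem1_general hΓ hfree G hG
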